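/- For integers $X\ge 1$, $q\ge 1$ and $a$, let $\tau(n)$ be the number of positive divisors of $n$, let $\gamma$ be the Euler–Mascheroni constant, and let $$S(X;a,q)=\sum_{\substack{1\le n\le X\\ n\equiv a\ (\mathrm{mod}\ q)}}\tau(n),\qquad r_d(a)=\sum_{e\mid\gcd(a,d)}e\,\mu(d/e),$$ $$M(X;a,q)=\frac{X}{q}\sum_{d\mid q}\frac{r_d(a)}{d}\bigl(\log X-2\log d+2\gamma-1\bigr),\qquad R(X;a,q)=S(X;a,q)-M(X;a,q).$$ (i) There is a function $\delta:\mathbb{N}\to\mathbb{R}$ with $\delta(q)\to0$ as $q\to\infty$ such that for all integers $A\ge 0$, $X$, $q\ge 1$ (with $q$ possibly composite) satisfying $$A\le q\qquad\text{and}\qquad X\ge q\ge X^{19/31},$$ and for every interval $\mathcal I=\{B+1,\dots,B+A\}$ of $A$ consecutive integers ($B\in\mathbb{Z}$), $$\Bigl|\sum_{a\in\mathcal I}R(X;a,q)\Bigr|\le\Bigl(AX^{1/2}q^{-1/2}+A^{1/8}X^{1/4}q^{1/2}+A^{1/2}X^{1/4}q^{1/4}\Bigr)q^{\delta(q)}.$$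 (ii) When $q$ is near $X^{2/3}$ this saves a power of $q$ over $AX/q$ as soon as $A\ge q^{3/7+\varepsilon}$: for every $\varepsilon>0$ there are $\eta>0$ and $K>0$, depending only on $\varepsilon$, such that for all integers $A\ge 0$, $X\ge 1$, $q\ge 1$ with $X^{2/3-\eta}\le q\le X^{2/3+\eta}$ and $q^{3/7+\varepsilon}\le A\le q$, and every interval $\mathcal I$ of $A$ consecutive integers, $$\Bigl|\sum_{a\in\mathcal I}R(X;a,q)\Bigr|\le K\,\frac{AX}{q}\,q^{-\eta}.$$ -/

import Mathlib

open Filter Topology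

namespace DivisorAP

/-- The divisor sum `S(X; a, q)`: the sum of `τ(n)` over `1 ≤ n ≤ X` with `n ≡ a (mod q)`. -/
def S (X : ℕ) (a : ℤ) (q : ℕ) : ℝ :=
  ∑ n ∈ (Finset.Icc 1 X).filter (fun n : ℕ => (n : ℤ) ≡ a [ZMOD (q : ℤ)]),
    (n.divisors.card : ℝ)

/-- The Ramanujan sum `r_d(a) = ∑_{e ∣ gcd(a, d)} e μ(d / e)` (for `d ≥ 1`). -/
def ramanujanSum (d : ℕ) (a : ℤ) : ℤ :=
  ∑ e ∈ (Int.gcd a (d : ℤ)).divisors, (e : ℤ) * ArithmeticFunction.moebius (d / e)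

/-- `P(T; q, a) = ∑_{d ∣ q} (r_d(a) / d) (T - 2 log d + 2γ - 1)`, with `γ` the Euler-Mascheroni
constant. -/
noncomputable def P (T : ℝ) (q : ℕ) (a : ℤ) : ℝ :=
  ∑ d ∈ q.divisors, (ramanujanSum d a : ℝ) / (d : ℝ) *
    (T - 2 * Real.log (d : ℝ) + 2 * Real.eulerMascheroniConstant - 1)

/-- The expected main term `M(X; a, q) = (X / q) P(log X; q, a)`. -/
noncomputable def M (X : ℕ) (a : ℤ) (q : ℕ) : ℝ :=
  (X : ℝ) / (q : ℝ) * P (Real.log (X : ℝ)) q a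

/-- The error term `R(X; a, q) = S(X; a, q) - M(X; a, q)`. -/
noncomputable def R (X : ℕ) (a : ℤ) (q : ℕ) : ℝ :=
  S X a q - M X a q

/-- The sum of `R(X; a, q)` over all integers `a` of the interval `{B + 1, …, B + A}`. -/
noncomputable def E (X : ℕ) (B : ℤ) (A q : ℕ) : ℝ :=
  ∑ a ∈ Finset.Ioc B (B + (A : ℤ)), R X a q

end DivisorAP

namespace DivisorAP

/-! Both parts follow from one elementary estimate, `exists_abs_E_le`: when `X ≤ q ^ 2` and `A ≤ q`,
the sum over the interval is `O(q ^ ε (A + √X))`.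

Detect `n ≡ a` by additive characters mod `q`. Frequency zero gives `A / q` times the full divisor
sum, which Dirichlet's formula evaluates; this matches the `d = 1` part of the averaged main term,
while the parts with `d > 1` are small because `r_d` has mean zero (`abs_sum_M_sub_le`). At a
frequency `1 ≤ h ≤ q / 2` the interval contributes at most `min(A, q / (2h))`, and the hyperbola
method turns the divisor sum into geometric sums with frequencies `h m / q`, `m ≤ √X`. Up to
harmonic terms, the product of the two is controlled by `l = h m` alone (`norm_intervalSum_mul_le`).
The divisor bound limits how often each `l` occurs, and summing over `l` in blocks of length `q`
costs only logarithms (`sum_norm_intervalSum_mul_le`).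

For (i), `A + √X` is at most the first two terms of the required bound (`add_sqrt_le_bound`); the
exponent `19/31` matters only through `X ≤ q ^ 2`. For (ii), when `q` is near `X ^ (2/3)`, `A + √X`
beats `A X / q` by a power once `A` exceeds `q ^ (1/4)` by a power, so `q ^ (3/7)` leaves ample
room. -/

/-! ### The divisor bound. -/

/-- The divisor bound `τ(n) ≪ n ^ ε`. -/
theorem exists_card_divisors_le {ε : ℝ} (hε : 0 < ε) :
    ∃ C : ℝ, 1 ≤ C ∧ ∀ n : ℕ, 1 ≤ n → (n.divisors.card : ℝ) ≤ C * (n : ℝ) ^ ε := by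
  -- With this `c`, `k + 1 ≤ c (1 + k ε log 2) ≤ c p ^ (k ε)` for every prime `p`. Primes `p ≥ N ≥ 2
  -- ^ (1 / ε)` have `p ^ ε ≥ 2` and need no constant, so the total loss is at most `c ^ N`.
  set c : ℝ := max 1 (1 / (ε * Real.log 2)) with hc
  have hlog2 : 0 < Real.log 2 := Real.log_pos one_lt_two
  have hc1 : 1 ≤ c := le_max_left _ _
  have hc2 : 1 ≤ c * (ε * Real.log 2) := by
    have h := mul_le_mul_of_nonneg_right (le_max_right 1 (1 / (ε * Real.log 2)))
      (mul_pos hε hlog2).le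
    rwa [one_div_mul_cancel (mul_pos hε hlog2).ne'] at h
  obtain ⟨N, hN⟩ := exists_nat_ge ((2 : ℝ) ^ (1 / ε))
  refine ⟨c ^ N, one_le_pow₀ hc1, fun n hn => ?_⟩
  have hn0 : n ≠ 0 := by omega
  have hfac : (n : ℝ) ^ ε = ∏ p ∈ n.primeFactors, ((p : ℝ) ^ n.factorization p) ^ ε := by
    conv_lhs => rw [← Nat.prod_factorization_pow_eq_self hn0]
    rw [Finsupp.prod, Nat.support_factorization, Nat.cast_prod, Real.finsetProd_rpow]
    · simp
    · intro i _
      positivity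
  have hprod : ∏ p ∈ n.primeFactors, (if p < N then c else 1) ≤ c ^ N := by
    rw [Finset.prod_ite, Finset.prod_const, Finset.prod_const_one, mul_one]
    refine pow_le_pow_right₀ hc1 ?_
    calc _ ≤ (Finset.range N).card := Finset.card_le_card fun p hp => by
            simpa using (Finset.mem_filter.1 hp).2
      _ = N := Finset.card_range N
  rw [Nat.card_divisors hn0, Nat.cast_prod, hfac]
  calc ∏ p ∈ n.primeFactors, ((n.factorization p + 1 : ℕ) : ℝ)
      ≤ ∏ p ∈ n.primeFactors,
          ((if p < N then c else 1) * ((p : ℝ) ^ n.factorization p) ^ ε) := by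
        refine Finset.prod_le_prod (fun _ _ => by positivity) fun p hp => ?_
        have hp2 : (2 : ℝ) ≤ p := by exact_mod_cast (Nat.prime_of_mem_primeFactors hp).two_le
        set k := n.factorization p
        push_cast
        split_ifs with hpN
        · have h1 : 1 + k * (ε * Real.log 2) ≤ ((p : ℝ) ^ k) ^ ε := by
            calc 1 + k * (ε * Real.log 2) ≤ Real.exp (k * (ε * Real.log 2)) := by
                  linarith [Real.add_one_le_exp (k * (ε * Real.log 2))]
              _ = ((2 : ℝ) ^ k) ^ ε := by
                  rw [← Real.rpow_natCast, ← Real.rpow_mul (by norm_num),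
                    Real.rpow_def_of_pos (by norm_num)]
                  ring_nf
              _ ≤ _ := by gcongr
          calc (k : ℝ) + 1 ≤ c * (1 + k * (ε * Real.log 2)) := by
                nlinarith [Nat.cast_nonneg (α := ℝ) k]
            _ ≤ _ := by gcongr
        · have hpN' : (2 : ℝ) ^ (1 / ε) ≤ p := hN.trans (by exact_mod_cast not_lt.1 hpN)
          have h2 : (2 : ℝ) ≤ (p : ℝ) ^ ε := by
            calc (2 : ℝ) = ((2 : ℝ) ^ (1 / ε)) ^ ε := by
                  rw [← Real.rpow_mul (by norm_num), one_div_mul_cancel hε.ne', Real.rpow_one]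
              _ ≤ _ := by gcongr
          have h3 : ((p : ℝ) ^ k) ^ ε = ((p : ℝ) ^ ε) ^ k := by
            rw [← Real.rpow_natCast, ← Real.rpow_mul (by positivity), mul_comm,
              Real.rpow_mul (by positivity), Real.rpow_natCast]
          rw [one_mul, h3]
          calc (k : ℝ) + 1 ≤ (2 : ℝ) ^ k := by exact_mod_cast Nat.lt_two_pow_self (n := k)
            _ ≤ _ := by gcongr
    _ = (∏ p ∈ n.primeFactors, (if p < N then c else 1)) *
          ∏ p ∈ n.primeFactors, ((p : ℝ) ^ n.factorization p) ^ ε := Finset.prod_mul_distrib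
    _ ≤ _ := by gcongr

/-! ### The hyperbola method. -/

theorem sum_card_divisors_mul {R : Type*} [CommRing R] (F : ℕ → R) (X : ℕ) :
    ∑ n ∈ Finset.Icc 1 X, (n.divisors.card : R) * F n =
      ∑ a ∈ Finset.Icc 1 X, ∑ b ∈ Finset.Icc 1 X, if a * b ≤ X then F (a * b) else 0 := by
  have h1 : ∀ n ∈ Finset.Icc 1 X, (n.divisors.card : R) * F n =
      ∑ p ∈ n.divisorsAntidiagonal, F (p.1 * p.2) := fun n _ => by
    rw [Finset.sum_congr rfl fun p hp => by rw [(Nat.mem_divisorsAntidiagonal.1 hp).1],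
      Finset.sum_const, nsmul_eq_mul, ← Nat.map_div_right_divisors, Finset.card_map]
  rw [Finset.sum_congr rfl h1, ← Finset.sum_product', ← Finset.sum_filter, Finset.sum_sigma']
  refine Finset.sum_bij' (fun x _ => x.2) (fun p _ => ⟨p.1 * p.2, p⟩) ?_ ?_ ?_ ?_ ?_
  · rintro ⟨n, a, b⟩ h
    simp only [Finset.mem_sigma, Finset.mem_Icc, Nat.mem_divisorsAntidiagonal] at h
    obtain ⟨⟨h1, h2⟩, rfl, h3⟩ := h
    have ha : 0 < a := Nat.pos_of_ne_zero (left_ne_zero_of_mul h3)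
    have hb : 0 < b := Nat.pos_of_ne_zero (right_ne_zero_of_mul h3)
    simp only [Finset.mem_filter, Finset.mem_product, Finset.mem_Icc]
    exact ⟨⟨⟨ha, by nlinarith⟩, hb, by nlinarith⟩, h2⟩
  · rintro ⟨a, b⟩ h
    simp only [Finset.mem_filter, Finset.mem_product, Finset.mem_Icc] at h
    simp only [Finset.mem_sigma, Finset.mem_Icc, Nat.mem_divisorsAntidiagonal]
    have : 0 < a * b := Nat.mul_pos h.1.1.1 h.1.2.1
    exact ⟨⟨this, h.2⟩, trivial, this.ne'⟩
  · rintro ⟨n, a, b⟩ h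
    simp only [Finset.mem_sigma, Finset.mem_Icc, Nat.mem_divisorsAntidiagonal] at h
    obtain ⟨⟨h1, h2⟩, rfl, h3⟩ := h
    rfl
  · rintro ⟨a, b⟩ h
    rfl
  · rintro ⟨n, a, b⟩ h
    rfl

/-- The Dirichlet hyperbola method for weighted sums of the divisor function. -/
theorem sum_card_divisors_mul_eq_hyperbola {R : Type*} [CommRing R] (F : ℕ → R) (X : ℕ) :
    ∑ n ∈ Finset.Icc 1 X, (n.divisors.card : R) * F n =
      ∑ m ∈ Finset.Icc 1 (Nat.sqrt X),
        (F (m * m) + 2 * ∑ n ∈ Finset.Ioc m (X / m), F (m * n)) := by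
  rw [sum_card_divisors_mul]
  set g : ℕ → ℕ → R := fun a b => if a * b ≤ X then F (a * b) else 0 with hg
  have hsymm : ∀ a b, g a b = g b a := fun a b => by simp only [hg, mul_comm]
  -- The diagonal is kept apart and the two halves `a < b`, `b < a` agree by symmetry; in the
  -- diagonal and the half `a < b`, the condition `a b ≤ X` forces `a ≤ √X`.
  have hsplit : ∀ a ∈ Finset.Icc 1 X, ∑ b ∈ Finset.Icc 1 X, g a b =
      ∑ b ∈ Finset.Icc 1 X, (if a < b then g a b else 0) + g a a +
        ∑ b ∈ Finset.Icc 1 X, (if b < a then g a b else 0) := fun a ha => by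
    have : g a a = ∑ b ∈ Finset.Icc 1 X, if b = a then g a b else 0 := by
      rw [Finset.sum_ite_eq' _ a, if_pos ha]
    rw [this, ← Finset.sum_add_distrib, ← Finset.sum_add_distrib]
    refine Finset.sum_congr rfl fun b _ => ?_
    rcases lt_trichotomy a b with h | h | h
    · simp [h, h.ne', h.not_gt]
    · simp [h]
    · simp [h, h.ne, h.not_gt]
  have hswap : ∑ a ∈ Finset.Icc 1 X, ∑ b ∈ Finset.Icc 1 X, (if b < a then g a b else 0) =
      ∑ a ∈ Finset.Icc 1 X, ∑ b ∈ Finset.Icc 1 X, (if a < b then g a b else 0) := by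
    rw [Finset.sum_comm]
    exact Finset.sum_congr rfl fun a _ => Finset.sum_congr rfl fun b _ => by rw [hsymm]
  have hsub : Finset.Icc 1 (Nat.sqrt X) ⊆ Finset.Icc 1 X :=
    Finset.Icc_subset_Icc_right (Nat.sqrt_le_self X)
  rw [Finset.sum_congr rfl hsplit, Finset.sum_add_distrib, Finset.sum_add_distrib, hswap,
    add_comm (∑ a ∈ Finset.Icc 1 X, ∑ b ∈ Finset.Icc 1 X, (if a < b then g a b else 0)),
    add_assoc, ← two_mul, Finset.sum_add_distrib, ← Finset.mul_sum]
  congr 1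
  · symm
    rw [Finset.sum_subset_zero_on_sdiff hsub (g := fun a => g a a)]
    · intro a ha
      simp only [Finset.mem_sdiff, Finset.mem_Icc, not_and, not_le] at ha
      exact if_neg (by have := Nat.sqrt_lt.1 (ha.2 ha.1.1); omega)
    · intro a ha
      exact (if_pos (Nat.le_sqrt.1 (Finset.mem_Icc.1 ha).2)).symm
  · congr 1
    symm
    rw [Finset.sum_subset_zero_on_sdiff hsub]
    · intro a ha
      simp only [Finset.mem_sdiff, Finset.mem_Icc, not_and, not_le] at ha
      have := Nat.sqrt_lt.1 (ha.2 ha.1.1)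
      refine Finset.sum_eq_zero fun b _ => ?_
      split_ifs with hab
      · exact if_neg (by nlinarith)
      · rfl
    · intro a ha
      have ha1 : 0 < a := (Finset.mem_Icc.1 ha).1
      rw [← Finset.sum_filter]
      have : (Finset.Icc 1 X).filter (fun b => a < b) = Finset.Ioc a X := by
        ext b
        simp only [Finset.mem_filter, Finset.mem_Icc, Finset.mem_Ioc]
        omega
      rw [this, hg, ← Finset.sum_filter]
      refine Finset.sum_congr ?_ fun _ _ => rfl
      ext b
      simp only [Finset.mem_filter, Finset.mem_Ioc, Nat.le_div_iff_mul_le ha1]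
      constructor
      · rintro ⟨h1, h2⟩
        exact ⟨⟨h1, by nlinarith⟩, by linarith⟩
      · rintro ⟨⟨h1, h2⟩, h3⟩
        exact ⟨h1, by linarith⟩

/-! ### Harmonic sums and Dirichlet's divisor formula. -/

theorem harmonic_eq_sum_one_div (n : ℕ) :
    (harmonic n : ℝ) = ∑ m ∈ Finset.Icc 1 n, 1 / (m : ℝ) := by
  rw [harmonic_eq_sum_Icc]
  push_cast
  simp

theorem sum_one_div_le (n : ℕ) : ∑ m ∈ Finset.Icc 1 n, 1 / (m : ℝ) ≤ 1 + Real.log n := by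
  rw [← harmonic_eq_sum_one_div]
  exact harmonic_le_one_add_log n

theorem abs_sum_one_div_sub_le {n : ℕ} (hn : 1 ≤ n) :
    |∑ m ∈ Finset.Icc 1 n, 1 / (m : ℝ) - (Real.log n + Real.eulerMascheroniConstant)| ≤
      1 / n := by
  rw [← harmonic_eq_sum_one_div]
  have h1 := Real.eulerMascheroniSeq_lt_eulerMascheroniConstant n
  have h2 := Real.eulerMascheroniConstant_lt_eulerMascheroniSeq' n
  rw [Real.eulerMascheroniSeq] at h1
  rw [Real.eulerMascheroniSeq', if_neg (by omega)] at h2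
  have hn0 : (0 : ℝ) < n := by exact_mod_cast hn
  have h3 : Real.log (n + 1) ≤ Real.log n + 1 / n := by
    have := Real.log_le_sub_one_of_pos (x := (n + 1) / n) (by positivity)
    rw [Real.log_div (by positivity) hn0.ne', add_div, div_self hn0.ne'] at this
    linarith
  rw [abs_le]
  constructor <;> linarith [one_div_pos.2 hn0]

/-- Dirichlet's asymptotic formula for the summatory function of the divisor function. -/
theorem abs_sum_card_divisors_sub_le {X : ℕ} (hX : 1 ≤ X) :
    |∑ n ∈ Finset.Icc 1 X, (n.divisors.card : ℝ) -
      X * (Real.log X + 2 * Real.eulerMascheroniConstant - 1)| ≤ 16 * √(X : ℝ) := by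
  set s := Nat.sqrt X with hs
  have hs1 : 1 ≤ s := Nat.sqrt_pos.2 hX
  have hs1' : (1 : ℝ) ≤ s := by exact_mod_cast hs1
  have hsX : (s : ℝ) * s ≤ X := by exact_mod_cast Nat.sqrt_le X
  have hXs : (X : ℝ) ≤ s * s + 2 * s := by
    have := Nat.sqrt_le_add X
    exact_mod_cast (by rw [← hs] at this; linarith : X ≤ s * s + 2 * s)
  have hsq : (s : ℝ) ≤ √(X : ℝ) := Real.le_sqrt_of_sq_le (by rw [sq]; exact hsX)
  have hX0 : (0 : ℝ) < X := by exact_mod_cast hX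
  have hXdiv : (X : ℝ) / s ≤ 3 * s := by
    rw [div_le_iff₀ (by linarith)]
    nlinarith
  set H := ∑ m ∈ Finset.Icc 1 s, 1 / (m : ℝ) with hH
  have hD : ∑ n ∈ Finset.Icc 1 X, (n.divisors.card : ℝ) =
      2 * ∑ m ∈ Finset.Icc 1 s, ((X / m : ℕ) : ℝ) - s * s := by
    have h := sum_card_divisors_mul_eq_hyperbola (fun _ => (1 : ℝ)) X
    simp only [mul_one, Finset.sum_const, Nat.card_Ioc, nsmul_eq_mul] at h
    rw [h, ← hs]
    have h2 : ∀ m ∈ Finset.Icc 1 s, (1 : ℝ) + 2 * ((X / m - m : ℕ) : ℝ) =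
        2 * ((X / m : ℕ) : ℝ) - (2 * m - 1) := fun m hm => by
      rw [Finset.mem_Icc] at hm
      have : m ≤ X / m := by
        rw [Nat.le_div_iff_mul_le hm.1]
        exact Nat.le_sqrt.1 hm.2
      rw [Nat.cast_sub this]
      ring
    rw [Finset.sum_congr rfl h2, Finset.sum_sub_distrib, ← Finset.mul_sum]
    congr 1
    have h3 : ∀ k : ℕ, ∑ m ∈ Finset.Icc 1 k, (2 * (m : ℝ) - 1) = k * k := fun k => by
      induction k with
      | zero => simp
      | succ k ih =>
        rw [Finset.sum_Icc_succ_top (by omega), ih]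
        push_cast
        ring
    exact h3 s
  have hfl1 : ∑ m ∈ Finset.Icc 1 s, ((X / m : ℕ) : ℝ) ≤ X * H := by
    rw [hH, Finset.mul_sum]
    refine Finset.sum_le_sum fun m _ => ?_
    rw [mul_one_div]
    exact Nat.cast_div_le
  have hfl2 : X * H - s ≤ ∑ m ∈ Finset.Icc 1 s, ((X / m : ℕ) : ℝ) := by
    have : (s : ℝ) = ∑ m ∈ Finset.Icc 1 s, (1 : ℝ) := by simp
    rw [hH, Finset.mul_sum, this, ← Finset.sum_sub_distrib]
    refine Finset.sum_le_sum fun m _ => ?_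
    rw [mul_one_div]
    have := Nat.lt_floor_add_one ((X : ℝ) / m)
    rw [Nat.floor_div_natCast, Nat.floor_natCast] at this
    linarith
  have hHb := abs_le.1 (abs_sum_one_div_sub_le hs1)
  rw [← hH] at hHb
  have hXH1 : X * (Real.log s + Real.eulerMascheroniConstant) - 3 * s ≤ X * H := by
    have : X * -(1 / (s : ℝ)) ≤ X * (H - (Real.log s + Real.eulerMascheroniConstant)) :=
      mul_le_mul_of_nonneg_left hHb.1 hX0.le
    rw [mul_neg, mul_one_div] at this
    linarith
  have hXH2 : X * H ≤ X * (Real.log s + Real.eulerMascheroniConstant) + 3 * s := by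
    have : X * (H - (Real.log s + Real.eulerMascheroniConstant)) ≤ X * (1 / (s : ℝ)) :=
      mul_le_mul_of_nonneg_left hHb.2 hX0.le
    rw [mul_one_div] at this
    linarith
  have hl1 : 2 * Real.log s ≤ Real.log X := by
    rw [two_mul, ← Real.log_mul (by positivity) (by positivity)]
    exact Real.log_le_log (by positivity) hsX
  -- Replacing `log X` by `2 log s` costs at most `X (X / s ^ 2 - 1) ≤ 2 X / s`, and `X ≤ s ^ 2 + 2
  -- s` makes this `O(s)`.
  have hl2 : X * Real.log X ≤ X * (2 * Real.log s) + 6 * s := by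
    have h := Real.log_le_sub_one_of_pos (x := X / (s * s)) (by positivity)
    rw [Real.log_div (by positivity) (by positivity), Real.log_mul (by positivity) (by positivity)]
      at h
    have h2 : X / (s * s : ℝ) - 1 ≤ 2 / s := by
      rw [div_sub_one (by positivity), div_le_div_iff₀ (by positivity) (by positivity)]
      nlinarith
    have h3 : X * (Real.log X - (Real.log s + Real.log s)) ≤ X * (2 / s) :=
      mul_le_mul_of_nonneg_left (h.trans h2) hX0.le
    have h4 : (X : ℝ) * (2 / s) = 2 * (X / s) := by ring
    linarith
  have hl1' := mul_le_mul_of_nonneg_left hl1 hX0.le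
  rw [hD, abs_le]
  constructor <;> nlinarith

/-! ### Additive characters and geometric sums. -/

/-- The additive character `k ↦ exp (2 π i k / q)`. -/
noncomputable def e (q : ℕ) (k : ℤ) : ℂ :=
  Complex.exp (Complex.I * ((2 * Real.pi * ((k : ℝ) / (q : ℝ)) : ℝ) : ℂ))

theorem e_zero (q : ℕ) : e q 0 = 1 := by simp [e]

theorem e_add (q : ℕ) (k l : ℤ) : e q (k + l) = e q k * e q l := by
  rw [e, e, e, ← Complex.exp_add]
  congr 1
  push_cast
  ring

theorem norm_e (q : ℕ) (k : ℤ) : ‖e q k‖ = 1 := by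
  rw [e, Complex.norm_exp_I_mul_ofReal]

theorem conj_e (q : ℕ) (k : ℤ) : (starRingEnd ℂ) (e q k) = e q (-k) := by
  rw [e, e, ← Complex.exp_conj, map_mul, Complex.conj_I, Complex.conj_ofReal]
  congr 1
  push_cast
  ring

theorem e_eq_one_of_dvd {q : ℕ} (hq : 1 ≤ q) {k : ℤ} (h : (q : ℤ) ∣ k) : e q k = 1 := by
  obtain ⟨j, rfl⟩ := h
  have hq0 : (q : ℝ) ≠ 0 := by positivity
  rw [e, Complex.exp_eq_one_iff]
  refine ⟨j, ?_⟩
  push_cast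
  rw [mul_div_cancel_left₀ _ (by exact_mod_cast hq0)]
  ring

theorem e_congr {q : ℕ} (hq : 1 ≤ q) {k l : ℤ} (h : (q : ℤ) ∣ k - l) : e q k = e q l := by
  rw [← sub_add_cancel k l, e_add, e_eq_one_of_dvd hq h, one_mul]

/-- The left side of Jordan's inequality `2 x / π ≤ sin x` on `[0, π / 2]`, since `|exp(i θ) - 1| =
2 |sin(θ / 2)|`. -/
theorem four_mul_div_le_norm_e_sub_one {q r : ℕ} (hq : 1 ≤ q) (hr : 2 * r ≤ q) :
    4 * (r : ℝ) / q ≤ ‖e q r - 1‖ := by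
  have hq0 : (0 : ℝ) < q := by exact_mod_cast hq
  have hr' : 2 * (r : ℝ) ≤ q := by exact_mod_cast hr
  have hx : (r : ℝ) / q ≤ 1 / 2 := by
    rw [div_le_div_iff₀ hq0 two_pos]
    linarith
  rw [e, Complex.norm_exp_I_mul_ofReal_sub_one, Real.norm_eq_abs]
  refine le_trans ?_ (le_abs_self _)
  have h := Real.mul_le_sin (x := Real.pi * (r / q)) (by positivity)
    (by nlinarith [Real.pi_pos])
  have h2 : 2 / Real.pi * (Real.pi * (r / q : ℝ)) = 2 * (r / q) := by
    field_simp
  have h3 : 2 * Real.pi * (((r : ℤ) : ℝ) / (q : ℝ)) / 2 = Real.pi * (r / q) := by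
    push_cast
    ring
  rw [h2] at h
  rw [h3, mul_div_assoc]
  linarith

theorem norm_e_sub_one_neg (q : ℕ) (k : ℤ) : ‖e q (-k) - 1‖ = ‖e q k - 1‖ := by
  rw [← conj_e, ← Complex.norm_conj, map_sub, Complex.conj_conj, map_one]

theorem four_mul_sub_div_le_norm_e_sub_one {q r : ℕ} (hq : 1 ≤ q) (hr : q ≤ 2 * r) (hrq : r ≤ q) :
    4 * ((q : ℝ) - r) / q ≤ ‖e q r - 1‖ := by
  have h := four_mul_div_le_norm_e_sub_one (r := q - r) hq (by omega)
  rw [Nat.cast_sub hrq] at h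
  refine h.trans_eq ?_
  rw [← norm_e_sub_one_neg q r]
  congr 2
  exact e_congr hq ⟨1, by push_cast [hrq]; ring⟩

/-- Adding the bounds for `r` near `0` and `r` near `q` avoids a case distinction when summing over
`r`; each yields a harmonic sum. -/
theorem two_div_norm_e_sub_one_le {q r : ℕ} (hr : 0 < r) (hrq : r < q) :
    2 / ‖e q r - 1‖ ≤ q * (1 / r + 1 / ((q : ℝ) - r)) := by
  have hr0 : (0 : ℝ) < r := by exact_mod_cast hr
  have hq0 : (0 : ℝ) < q := by exact_mod_cast hr.trans hrq
  have hqr : (0 : ℝ) < q - r := by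
    have : (r : ℝ) < q := by exact_mod_cast hrq
    linarith
  have key : ∀ t : ℝ, 0 < t → 4 * t / q ≤ ‖e q r - 1‖ → 2 / ‖e q r - 1‖ ≤ q * (1 / t) :=
    fun t ht h => by
      calc 2 / ‖e q r - 1‖ ≤ 2 / (4 * t / q) := by gcongr
        _ = q * (1 / t) / 2 := by field_simp; norm_num
        _ ≤ q * (1 / t) := half_le_self (by positivity)
  rw [mul_add]
  rcases le_total (2 * r) q with h | h
  · exact (key _ hr0 (four_mul_div_le_norm_e_sub_one (by omega) h)).trans
      (le_add_of_nonneg_right (by positivity))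
  · exact (key _ hqr (four_mul_sub_div_le_norm_e_sub_one (by omega) h hrq.le)).trans
      (le_add_of_nonneg_left (by positivity))

theorem norm_e_sub_one_pos {q : ℕ} (hq : 1 ≤ q) {k : ℤ} (hk : ¬ (q : ℤ) ∣ k) :
    0 < ‖e q k - 1‖ := by
  have hq0 : (0 : ℤ) < q := by exact_mod_cast hq
  obtain ⟨r, hr⟩ := Int.eq_ofNat_of_zero_le (Int.emod_nonneg k hq0.ne')
  have hrq : r < q := by
    have := Int.emod_lt_of_pos k hq0
    omega
  have hr0 : 0 < r := by
    rw [Nat.pos_iff_ne_zero]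
    rintro rfl
    exact hk (Int.dvd_of_emod_eq_zero (by simpa using hr))
  have hek : e q k = e q r := e_congr hq (by rw [← hr]; exact Int.dvd_self_sub_emod)
  rw [hek]
  have hqR : (0 : ℝ) < q := by exact_mod_cast hq
  have hrR : (0 : ℝ) < r := by exact_mod_cast hr0
  have hqr : (0 : ℝ) < q - r := by
    have : (r : ℝ) < q := by exact_mod_cast hrq
    linarith
  rcases le_total (2 * r) q with h | h
  · exact lt_of_lt_of_le (by positivity) (four_mul_div_le_norm_e_sub_one hq h)
  · exact lt_of_lt_of_le (by positivity) (four_mul_sub_div_le_norm_e_sub_one hq h hrq.le)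

theorem e_sub_one_mul_sum (q : ℕ) (k : ℤ) {u v : ℕ} (huv : u ≤ v) :
    (e q k - 1) * ∑ n ∈ Finset.Ioc u v, e q (k * n) = e q (k * (v + 1)) - e q (k * (u + 1)) := by
  induction v, huv using Nat.le_induction with
  | base => simp
  | succ v huv ih =>
    rw [Finset.sum_Ioc_succ_top (by omega), mul_add, ih, sub_mul, ← e_add]
    push_cast
    rw [show k + k * ((v : ℤ) + 1) = k * ((v : ℤ) + 1 + 1) by ring]
    ring

theorem norm_sum_e_le {q : ℕ} (hq : 1 ≤ q) {k : ℤ} (hk : ¬ (q : ℤ) ∣ k) (u v : ℕ) :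
    ‖∑ n ∈ Finset.Ioc u v, e q (k * n)‖ ≤ 2 / ‖e q k - 1‖ := by
  have hpos := norm_e_sub_one_pos hq hk
  rcases le_total u v with huv | huv
  · rw [le_div_iff₀ hpos, mul_comm, ← norm_mul, e_sub_one_mul_sum q k huv]
    refine (norm_sub_le _ _).trans ?_
    rw [norm_e, norm_e]
    norm_num
  · rw [Finset.Ioc_eq_empty_of_le huv, Finset.sum_empty, norm_zero]
    positivity

theorem sum_range_e {q : ℕ} (hq : 1 ≤ q) (k : ℤ) :
    ∑ h ∈ Finset.range q, e q (h * k) = if (q : ℤ) ∣ k then (q : ℂ) else 0 := by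
  split_ifs with hk
  · rw [Finset.sum_congr rfl fun h _ => e_eq_one_of_dvd hq (hk.mul_left _)]
    simp
  · have h1 : ∑ h ∈ Finset.range q, e q (h * k) = ∑ n ∈ Finset.Ioc 0 q, e q (k * n) := by
      -- The two ranges differ only in their endpoints `0` and `N`, whose terms are both `1` when `N
      -- = q`.
      have h2 : ∀ N : ℕ, ∑ h ∈ Finset.range N, e q (h * k) + e q (k * N) =
          1 + ∑ n ∈ Finset.Ioc 0 N, e q (k * n) := fun N => by
        induction N with
        | zero => simp [e_zero]
        | succ N ih =>
          rw [Finset.sum_range_succ, Finset.sum_Ioc_succ_top (by omega), mul_comm (N : ℤ) k, ih]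
          ring
      have h3 := h2 q
      rw [e_eq_one_of_dvd hq (dvd_mul_left _ _), add_comm] at h3
      exact add_left_cancel h3
    rw [h1]
    have h4 := e_sub_one_mul_sum q k (Nat.zero_le q)
    rw [e_congr hq (k := k * (q + 1)) (l := k * ((0 : ℕ) + 1)) ⟨k, by push_cast; ring⟩,
      sub_self] at h4
    exact (mul_eq_zero.1 h4).resolve_left (norm_pos_iff.1 (norm_e_sub_one_pos hq hk))

/-! ### Fourier expansion over residues. -/

/-- The exponential sum over the interval `{B + 1, …, B + A}`. -/
noncomputable def intervalSum (q : ℕ) (B : ℤ) (A : ℕ) (h : ℤ) : ℂ :=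
  ∑ a ∈ Finset.Ioc B (B + (A : ℤ)), e q (-(h * a))

/-- The exponential sum over `n ≤ X` weighted by the divisor function. -/
noncomputable def divisorSum (q X : ℕ) (h : ℤ) : ℂ :=
  ∑ n ∈ Finset.Icc 1 X, (n.divisors.card : ℂ) * e q (h * n)

theorem sum_S_eq {q : ℕ} (hq : 1 ≤ q) (X : ℕ) (B : ℤ) (A : ℕ) :
    ((∑ a ∈ Finset.Ioc B (B + (A : ℤ)), S X a q : ℝ) : ℂ) =
      1 / q * ∑ h ∈ Finset.range q, intervalSum q B A h * divisorSum q X h := by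
  have hq0 : (q : ℂ) ≠ 0 := by exact_mod_cast (by omega : q ≠ 0)
  have h1 : ∀ h : ℕ, intervalSum q B A h * divisorSum q X h =
      ∑ a ∈ Finset.Ioc B (B + (A : ℤ)), ∑ n ∈ Finset.Icc 1 X,
        (n.divisors.card : ℂ) * e q (h * (n - a)) := fun h => by
    rw [intervalSum, divisorSum, Finset.sum_mul_sum]
    refine Finset.sum_congr rfl fun a _ => Finset.sum_congr rfl fun n _ => ?_
    rw [mul_sub, sub_eq_neg_add, e_add]
    ring
  rw [Finset.sum_congr rfl fun h _ => h1 h, Finset.sum_comm, Finset.mul_sum, Complex.ofReal_sum]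
  refine Finset.sum_congr rfl fun a _ => ?_
  rw [Finset.sum_comm, Finset.mul_sum, S, Finset.sum_filter, Complex.ofReal_sum]
  refine Finset.sum_congr rfl fun n _ => ?_
  rw [← Finset.mul_sum, sum_range_e hq]
  have h2 : (n : ℤ) ≡ a [ZMOD q] ↔ (q : ℤ) ∣ n - a := by
    rw [Int.modEq_comm, Int.modEq_iff_dvd]
  by_cases hd : (q : ℤ) ∣ n - a
  · rw [if_pos hd, if_pos (h2.2 hd)]
    field_simp
    simp
  · rw [if_neg hd, if_neg (fun h => hd (h2.1 h))]
    simp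

/-- Conjugation sends `h` to `-h ≡ q - h`. Together with its analogue for `divisorSum`, this folds
the frequencies into `h ≤ q / 2`, where `h / q` is its own distance to the nearest integer. -/
theorem norm_intervalSum_symm {q : ℕ} (hq : 1 ≤ q) (B : ℤ) (A : ℕ) (h : ℤ) :
    ‖intervalSum q B A (q - h)‖ = ‖intervalSum q B A h‖ := by
  rw [← Complex.norm_conj, intervalSum, intervalSum, map_sum]
  congr 1
  refine Finset.sum_congr rfl fun a _ => ?_
  rw [conj_e]
  exact e_congr hq ⟨a, by ring⟩

theorem norm_divisorSum_symm {q : ℕ} (hq : 1 ≤ q) (X : ℕ) (h : ℤ) :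
    ‖divisorSum q X (q - h)‖ = ‖divisorSum q X h‖ := by
  rw [← Complex.norm_conj, divisorSum, divisorSum, map_sum]
  congr 1
  refine Finset.sum_congr rfl fun n _ => ?_
  rw [map_mul, conj_e, Complex.conj_natCast]
  congr 1
  exact e_congr hq ⟨-n, by ring⟩

theorem sum_Ico_le_two_mul_of_symm {q : ℕ} (f : ℕ → ℝ) (hf : ∀ h, 0 ≤ f h)
    (hsymm : ∀ h ≤ q, f (q - h) = f h) :
    ∑ h ∈ Finset.Ico 1 q, f h ≤ 2 * ∑ h ∈ Finset.Icc 1 (q / 2), f h := by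
  rw [← Finset.sum_filter_add_sum_filter_not _ (fun h => 2 * h ≤ q), two_mul]
  refine add_le_add ?_ ?_
  · refine Finset.sum_le_sum_of_subset_of_nonneg (fun h hh => ?_) fun h _ _ => hf h
    simp only [Finset.mem_filter, Finset.mem_Ico, Finset.mem_Icc] at hh ⊢
    omega
  · have hinj : Set.InjOn (fun h => q - h)
        ((Finset.Ico 1 q).filter (fun h => ¬ 2 * h ≤ q) : Set ℕ) := fun a ha b hb hab => by
      simp only [Finset.coe_filter, Finset.mem_Ico, Set.mem_ofPred_eq] at ha hb hab
      omega
    have h1 : ∑ h ∈ (Finset.Ico 1 q).filter (fun h => ¬ 2 * h ≤ q), f h =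
        ∑ h ∈ ((Finset.Ico 1 q).filter (fun h => ¬ 2 * h ≤ q)).image (fun h => q - h), f h := by
      rw [Finset.sum_image hinj]
      refine Finset.sum_congr rfl fun h hh => (hsymm h ?_).symm
      simp only [Finset.mem_filter, Finset.mem_Ico] at hh
      omega
    rw [h1]
    refine Finset.sum_le_sum_of_subset_of_nonneg (fun h hh => ?_) fun h _ _ => hf h
    simp only [Finset.mem_image, Finset.mem_filter, Finset.mem_Ico, Finset.mem_Icc] at hh ⊢
    obtain ⟨a, ha, rfl⟩ := hh
    omega

theorem abs_sum_S_sub_le {q : ℕ} (hq : 1 ≤ q) (X : ℕ) (B : ℤ) (A : ℕ) :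
    |∑ a ∈ Finset.Ioc B (B + (A : ℤ)), S X a q -
        A / q * ∑ n ∈ Finset.Icc 1 X, (n.divisors.card : ℝ)| ≤
      2 / q * ∑ h ∈ Finset.Icc 1 (q / 2), ‖intervalSum q B A h‖ * ‖divisorSum q X h‖ := by
  have h0 : ((∑ a ∈ Finset.Ioc B (B + (A : ℤ)), S X a q -
        A / q * ∑ n ∈ Finset.Icc 1 X, (n.divisors.card : ℝ) : ℝ) : ℂ) =
      1 / q * ∑ h ∈ Finset.Ico 1 q, intervalSum q B A h * divisorSum q X h := by
    rw [Complex.ofReal_sub, sum_S_eq hq, Finset.range_eq_Ico, Finset.sum_eq_sum_Ico_succ_bot hq,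
      mul_add]
    have h1 : intervalSum q B A (0 : ℕ) = A := by
      simp [intervalSum, e_zero]
    have h2 : divisorSum q X (0 : ℕ) = ∑ n ∈ Finset.Icc 1 X, (n.divisors.card : ℂ) := by
      simp [divisorSum, e_zero]
    rw [h1, h2]
    push_cast
    ring
  rw [← Real.norm_eq_abs, ← Complex.norm_real, h0, norm_mul]
  have h3 : ‖(1 / q : ℂ)‖ = 1 / q := by simp
  rw [h3]
  have h4 := sum_Ico_le_two_mul_of_symm (q := q)
    (fun h => ‖intervalSum q B A h‖ * ‖divisorSum q X h‖) (fun h => by positivity)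
    (fun h hh => by
      simp only [Nat.cast_sub hh, norm_intervalSum_symm hq, norm_divisorSum_symm hq])
  calc 1 / (q : ℝ) * ‖∑ h ∈ Finset.Ico 1 q, intervalSum q B A h * divisorSum q X h‖
      ≤ 1 / q * ∑ h ∈ Finset.Ico 1 q, ‖intervalSum q B A h‖ * ‖divisorSum q X h‖ := by
        gcongr
        refine (norm_sum_le _ _).trans_eq (Finset.sum_congr rfl fun h _ => norm_mul _ _)
    _ ≤ 1 / q * (2 * ∑ h ∈ Finset.Icc 1 (q / 2), ‖intervalSum q B A h‖ * ‖divisorSum q X h‖) := by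
        gcongr
    _ = _ := by ring

/-! ### Bounds at a single frequency. -/

theorem norm_intervalSum_le_card (q : ℕ) (B : ℤ) (A : ℕ) (h : ℤ) : ‖intervalSum q B A h‖ ≤ A := by
  refine (norm_sum_le _ _).trans_eq ?_
  simp [norm_e]

theorem norm_intervalSum_le {q h : ℕ} (B : ℤ) (A : ℕ) (hh : 1 ≤ h) (hhq : 2 * h ≤ q) :
    ‖intervalSum q B A h‖ ≤ q / (2 * h) := by
  have hq : 1 ≤ q := by omega
  have hq0 : (0 : ℝ) < q := by exact_mod_cast hq
  have hh0 : (0 : ℝ) < h := by exact_mod_cast hh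
  have h1 : intervalSum q B A h = e q (-(h * B)) * ∑ n ∈ Finset.Ioc 0 A, e q (-h * n) := by
    rw [intervalSum, Finset.mul_sum]
    symm
    refine Finset.sum_bij (fun n _ => B + (n : ℤ)) ?_ ?_ ?_ ?_
    · intro n hn
      simp only [Finset.mem_Ioc] at hn ⊢
      omega
    · intro a _ b _ hab
      simpa using hab
    · intro b hb
      simp only [Finset.mem_Ioc] at hb
      refine ⟨(b - B).toNat, ?_, ?_⟩
      · simp only [Finset.mem_Ioc]
        omega
      · omega
    · intro n _
      rw [← e_add]
      congr 1
      ring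
  have hnd : ¬ (q : ℤ) ∣ -(h : ℤ) := fun hd => by
    have := Nat.le_of_dvd (by omega) (Int.natCast_dvd_natCast.1 (dvd_neg.1 hd))
    omega
  rw [h1, norm_mul, norm_e, one_mul]
  refine (norm_sum_e_le hq hnd 0 A).trans ?_
  rw [norm_e_sub_one_neg]
  calc 2 / ‖e q h - 1‖ ≤ 2 / (4 * (h : ℝ) / q) := by
        gcongr
        exact four_mul_div_le_norm_e_sub_one hq hhq
    _ = _ := by field_simp; norm_num

theorem norm_divisorSum_le (q X : ℕ) (h : ℤ) :
    ‖divisorSum q X h‖ ≤ Nat.sqrt X +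
      2 * ∑ m ∈ Finset.Icc 1 (Nat.sqrt X), ‖∑ n ∈ Finset.Ioc m (X / m), e q (h * m * n)‖ := by
  rw [divisorSum, sum_card_divisors_mul_eq_hyperbola (fun n => e q (h * n)) X,
    Finset.sum_add_distrib, ← Finset.mul_sum]
  refine (norm_add_le _ _).trans (add_le_add ?_ ?_)
  · refine (norm_sum_le _ _).trans_eq ?_
    simp [norm_e]
  · rw [norm_mul, Complex.norm_ofNat]
    gcongr
    refine (norm_sum_le _ _).trans_eq (Finset.sum_congr rfl fun m _ => ?_)
    congr 1
    refine Finset.sum_congr rfl fun n _ => ?_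
    push_cast
    rw [mul_assoc]

theorem sum_range_mul_eq {R : Type*} [AddCommMonoid R] (f : ℕ → R) (q n : ℕ) :
    ∑ l ∈ Finset.range (q * n), f l =
      ∑ i ∈ Finset.range n, ∑ r ∈ Finset.range q, f (q * i + r) := by
  induction n with
  | zero => simp
  | succ n ih => rw [Nat.mul_succ, Finset.sum_range_add, ih, Finset.sum_range_succ]

/-- A majorant, depending on `r = l % q`, of `m` times an exponential sum with frequency `l / q`
over at most `X / m` integers, for `m ≤ √X`. -/
noncomputable def majorant (q X r : ℕ) : ℝ :=
  if r = 0 then X else Nat.sqrt X * (q * (1 / r + 1 / ((q : ℝ) - r)))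

theorem majorant_nonneg {q r : ℕ} (X : ℕ) (hr : r < q) : 0 ≤ majorant q X r := by
  have : (r : ℝ) < q := by exact_mod_cast hr
  have h2 : (0 : ℝ) < q - r := by linarith
  rw [majorant]
  split_ifs <;> positivity

/-- The factor `m` removes the dependence on `m`: without cancellation, `m` times at most `X / m`
terms is at most `X`; otherwise `m ≤ √X` multiplies the geometric sum bound. -/
theorem mul_norm_sum_e_le_majorant {q X m : ℕ} (hq : 1 ≤ q) (l : ℕ) (hm : m ≤ Nat.sqrt X) :
    m * ‖∑ n ∈ Finset.Ioc m (X / m), e q (l * n)‖ ≤ majorant q X (l % q) := by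
  rw [majorant]
  split_ifs with h
  · have h1 : ‖∑ n ∈ Finset.Ioc m (X / m), e q (l * n)‖ ≤ (X / m : ℕ) := by
      refine (norm_sum_le _ _).trans ?_
      simp only [norm_e, Finset.sum_const, Nat.card_Ioc, nsmul_eq_mul, mul_one]
      exact_mod_cast Nat.sub_le _ _
    calc m * ‖∑ n ∈ Finset.Ioc m (X / m), e q (l * n)‖ ≤ m * (X / m : ℕ) := by gcongr
      _ ≤ X := by exact_mod_cast Nat.mul_div_le X m
  · have hnd : ¬ (q : ℤ) ∣ l := fun hd => h (Nat.mod_eq_zero_of_dvd (Int.natCast_dvd_natCast.1 hd))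
    have hl : e q l = e q (l % q : ℕ) := e_congr hq (by push_cast; exact Int.dvd_self_sub_emod)
    have h2 := norm_sum_e_le hq hnd m (X / m)
    rw [hl] at h2
    have h3 := h2.trans (two_div_norm_e_sub_one_le (Nat.pos_of_ne_zero h) (Nat.mod_lt l hq))
    gcongr

/-- For `2 h m ≤ q` the trivial bound `A` meets a geometric sum of size `q / (2 h m)`. For larger `h
m` the bound `q / (2 h)` is traded for `m / (⌊h m / q⌋ + 1)`, whose factor `m` the majorant absorbs.
-/
theorem norm_intervalSum_mul_le {q X h m : ℕ} (B : ℤ) (A : ℕ) (hh : 1 ≤ h) (hhq : 2 * h ≤ q)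
    (hm : 1 ≤ m) (hmX : m ≤ Nat.sqrt X) :
    ‖intervalSum q B A h‖ * ‖∑ n ∈ Finset.Ioc m (X / m), e q (h * m * n)‖ ≤
      A * q / 2 * (1 / h * (1 / m)) +
        majorant q X (h * m % q) * (1 / ((h * m / q : ℕ) + 1 : ℝ)) := by
  have hq : 1 ≤ q := by omega
  have hq0 : (0 : ℝ) < q := by exact_mod_cast hq
  have hh0 : (0 : ℝ) < h := by exact_mod_cast hh
  have hm0 : (0 : ℝ) < m := by exact_mod_cast hm
  have hV : 0 ≤ majorant q X (h * m % q) := majorant_nonneg X (Nat.mod_lt _ hq)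
  have hcast : ∀ n : ℕ, e q (h * m * n) = e q ((h * m : ℕ) * n) := fun n => by push_cast; rfl
  simp only [hcast]
  rcases le_total (2 * (h * m)) q with hl | hl
  · have hnd : ¬ (q : ℤ) ∣ (h * m : ℕ) := fun hd => by
      have h0 : 0 < h * m := Nat.mul_pos hh hm
      have := Nat.le_of_dvd h0 (Int.natCast_dvd_natCast.1 hd)
      omega
    have h1 : ‖∑ n ∈ Finset.Ioc m (X / m), e q ((h * m : ℕ) * n)‖ ≤ q / 2 * (1 / h * (1 / m)) := by
      refine (norm_sum_e_le hq hnd _ _).trans ?_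
      calc 2 / ‖e q (h * m : ℕ) - 1‖ ≤ 2 / (4 * ((h * m : ℕ) : ℝ) / q) := by
            have h0 : 0 < h * m := Nat.mul_pos hh hm
            gcongr
            exact four_mul_div_le_norm_e_sub_one hq hl
        _ = _ := by
            push_cast
            field_simp
            norm_num
    calc _ ≤ A * (q / 2 * (1 / h * (1 / m)) : ℝ) :=
          mul_le_mul (norm_intervalSum_le_card _ _ _ _) h1 (norm_nonneg _) (by positivity)
      _ = A * q / 2 * (1 / h * (1 / m)) := by ring
      _ ≤ _ := le_add_of_nonneg_right (by positivity)
  · have h1 := mul_norm_sum_e_le_majorant (X := X) hq (h * m) hmX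
    have h2 := norm_intervalSum_le B A hh hhq
    -- With `i = ⌊h m / q⌋`: for `i = 0` this is the case assumption, and for `i ≥ 1` one has `i + 1
    -- ≤ 2 i`.
    have hi : q * (h * m / q + 1) ≤ 2 * (h * m) := by
      have hdm := Nat.mul_div_le (h * m) q
      rcases Nat.eq_zero_or_pos (h * m / q) with h0 | h0
      · rw [h0]
        omega
      · nlinarith
    have hi' : (q : ℝ) * ((h * m / q : ℕ) + 1) ≤ 2 * (h * m) := by exact_mod_cast hi
    have h3 : (q : ℝ) / (2 * h) ≤ m * (1 / ((h * m / q : ℕ) + 1)) := by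
      rw [mul_one_div, div_le_div_iff₀ (by positivity) (by positivity)]
      linarith
    calc _ ≤ m * (1 / ((h * m / q : ℕ) + 1 : ℝ)) *
            ‖∑ n ∈ Finset.Ioc m (X / m), e q ((h * m : ℕ) * n)‖ := by
          gcongr
          exact h2.trans h3
      _ = m * ‖∑ n ∈ Finset.Ioc m (X / m), e q ((h * m : ℕ) * n)‖ *
            (1 / ((h * m / q : ℕ) + 1 : ℝ)) := by ring
      _ ≤ majorant q X (h * m % q) * (1 / ((h * m / q : ℕ) + 1 : ℝ)) := by gcongr
      _ ≤ _ := le_add_of_nonneg_left (by positivity)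

/-! ### Summation over the frequencies. -/

/-- Grouping pairs by their product, each value is taken at most `D` times. -/
theorem sum_sum_mul_le {a b N : ℕ} {D : ℝ} (U : ℕ → ℝ) (hU : ∀ l, 0 ≤ U l) (hab : a * b < N)
    (hD : ∀ l, 1 ≤ l → l ≤ N → (l.divisors.card : ℝ) ≤ D) :
    ∑ h ∈ Finset.Icc 1 a, ∑ m ∈ Finset.Icc 1 b, U (h * m) ≤ D * ∑ l ∈ Finset.range N, U l := by
  rw [← Finset.sum_product', Finset.mul_sum]
  have hmaps : ∀ p ∈ Finset.Icc 1 a ×ˢ Finset.Icc 1 b, p.1 * p.2 ∈ Finset.range N := by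
    intro p hp
    simp only [Finset.mem_product, Finset.mem_Icc] at hp
    rw [Finset.mem_range]
    exact (Nat.mul_le_mul hp.1.2 hp.2.2).trans_lt hab
  rw [← Finset.sum_fiberwise_of_maps_to hmaps]
  refine Finset.sum_le_sum fun l hl => ?_
  rw [Finset.sum_congr rfl fun p hp => by rw [(Finset.mem_filter.1 hp).2], Finset.sum_const,
    nsmul_eq_mul]
  rcases Nat.eq_zero_or_pos l with rfl | hl0
  · rw [Finset.filter_eq_empty_iff.2]
    · have : (0 : ℝ) ≤ D := by
        have hN : 0 < N := by omega
        exact (Nat.cast_nonneg _).trans (hD 1 le_rfl hN)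
      simpa using mul_nonneg this (hU 0)
    · intro p hp h0
      simp only [Finset.mem_product, Finset.mem_Icc] at hp
      have := Nat.mul_pos hp.1.1 hp.2.1
      omega
  · refine mul_le_mul_of_nonneg_right ?_ (hU l)
    refine le_trans ?_ (hD l hl0 (Finset.mem_range.1 hl).le)
    refine Nat.cast_le.2 (Finset.card_le_card_of_injOn Prod.fst ?_ ?_)
    · intro p hp
      have hp2 := (Finset.mem_filter.1 hp).2
      exact Nat.mem_divisors.2 ⟨⟨p.2, hp2.symm⟩, hl0.ne'⟩
    · intro p hp p' hp' h
      have h1 := (Finset.mem_filter.1 hp).2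
      have h2 := (Finset.mem_filter.1 hp').2
      have h3 : 0 < p.1 := Nat.pos_of_ne_zero fun h0 => by
        rw [h0, zero_mul] at h1
        omega
      have h4 : p.1 * p.2 = p.1 * p'.2 := by rw [h1, h, h2]
      exact Prod.ext h (Nat.eq_of_mul_eq_mul_left h3 h4)

theorem sum_majorant_le {q : ℕ} (hq : 1 ≤ q) (X : ℕ) :
    ∑ r ∈ Finset.range q, majorant q X r ≤
      X + 2 * Nat.sqrt X * q * ∑ m ∈ Finset.Icc 1 q, 1 / (m : ℝ) := by
  have h0 : ∑ r ∈ Finset.Ico 1 q, 1 / (r : ℝ) ≤ ∑ m ∈ Finset.Icc 1 q, 1 / (m : ℝ) :=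
    Finset.sum_le_sum_of_subset_of_nonneg Finset.Ico_subset_Icc_self fun _ _ _ => by positivity
  -- Reflection `r ↦ q - r`.
  have h1 : ∑ r ∈ Finset.Ico 1 q, 1 / ((q : ℝ) - r) = ∑ r ∈ Finset.Ico 1 q, 1 / (r : ℝ) := by
    refine Finset.sum_bij' (fun r _ => q - r) (fun r _ => q - r) ?_ ?_ ?_ ?_ ?_
    · intro r hr
      simp only [Finset.mem_Ico] at hr ⊢
      omega
    · intro r hr
      simp only [Finset.mem_Ico] at hr ⊢
      omega
    · intro r hr
      simp only [Finset.mem_Ico] at hr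
      omega
    · intro r hr
      simp only [Finset.mem_Ico] at hr
      omega
    · intro r hr
      simp only [Finset.mem_Ico] at hr
      rw [Nat.cast_sub hr.2.le]
  have h2 : ∀ r ∈ Finset.Ico 1 q, majorant q X r =
      Nat.sqrt X * q * (1 / r + 1 / ((q : ℝ) - r)) := fun r hr => by
    rw [Finset.mem_Ico] at hr
    rw [majorant, if_neg (by omega)]
    ring
  rw [Finset.range_eq_Ico, Finset.sum_eq_sum_Ico_succ_bot hq, zero_add, Finset.sum_congr rfl h2,
    ← Finset.mul_sum, Finset.sum_add_distrib, h1]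
  have h3 : majorant q X 0 = X := if_pos rfl
  have h4 : (Nat.sqrt X * q : ℝ) *
      (∑ r ∈ Finset.Ico 1 q, 1 / (r : ℝ) + ∑ r ∈ Finset.Ico 1 q, 1 / (r : ℝ)) ≤
      Nat.sqrt X * q * (∑ m ∈ Finset.Icc 1 q, 1 / (m : ℝ) + ∑ m ∈ Finset.Icc 1 q, 1 / (m : ℝ)) := by
    gcongr
  rw [h3]
  linarith

/-- Since `h ≤ q / 2` and `m ≤ √X ≤ q`, every product `h m` lies below `q ^ 2`. Writing it as `q i +
r` factors the majorised sum into `∑ 1 / (i + 1)` and a sum of the majorant over one period. -/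
theorem sum_norm_intervalSum_mul_le {q X : ℕ} (hq : 1 ≤ q) (hX : X ≤ q ^ 2) (B : ℤ) (A : ℕ)
    {D : ℝ} (hD : ∀ l : ℕ, 1 ≤ l → l ≤ q ^ 2 → (l.divisors.card : ℝ) ≤ D) {L : ℝ}
    (hL : ∑ m ∈ Finset.Icc 1 q, 1 / (m : ℝ) ≤ L) :
    ∑ h ∈ Finset.Icc 1 (q / 2), ‖intervalSum q B A h‖ * ‖divisorSum q X h‖ ≤
      Nat.sqrt X * q / 2 * L +
        2 * (A * q / 2 * (L * L) + D * (L * (X + 2 * Nat.sqrt X * q * L))) := by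
  set s := Nat.sqrt X with hs
  have hsq : s ≤ q := by
    rw [hs, ← Nat.sqrt_eq' q]
    exact Nat.sqrt_le_sqrt hX
  have hD0 : 0 ≤ D := (Nat.cast_nonneg _).trans (hD 1 le_rfl (Nat.one_le_pow _ _ hq))
  have hsub : ∀ k ≤ q, ∑ m ∈ Finset.Icc 1 k, 1 / (m : ℝ) ≤ L := fun k hk =>
    (Finset.sum_le_sum_of_subset_of_nonneg (Finset.Icc_subset_Icc_right hk)
      fun _ _ _ => by positivity).trans hL
  have hL0 : 0 ≤ L := le_trans (Finset.sum_nonneg fun _ _ => by positivity) hL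
  set U : ℕ → ℝ := fun l => majorant q X (l % q) * (1 / ((l / q : ℕ) + 1 : ℝ)) with hU
  have hU0 : ∀ l, 0 ≤ U l := fun l =>
    mul_nonneg (majorant_nonneg X (Nat.mod_lt _ hq)) (by positivity)
  have hterm : ∀ h ∈ Finset.Icc 1 (q / 2), ‖intervalSum q B A h‖ * ‖divisorSum q X h‖ ≤
      s * q / 2 * (1 / h) + 2 * ∑ m ∈ Finset.Icc 1 s,
        (A * q / 2 * (1 / h * (1 / m)) + U (h * m)) := by
    intro h hh
    rw [Finset.mem_Icc] at hh
    have hhq : 2 * h ≤ q := by omega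
    have hh0 : (0 : ℝ) < h := by exact_mod_cast hh.1
    calc ‖intervalSum q B A h‖ * ‖divisorSum q X h‖
        ≤ ‖intervalSum q B A h‖ * (s +
          2 * ∑ m ∈ Finset.Icc 1 s, ‖∑ n ∈ Finset.Ioc m (X / m), e q (h * m * n)‖) := by
          gcongr
          exact norm_divisorSum_le q X h
      _ = ‖intervalSum q B A h‖ * s + 2 * ∑ m ∈ Finset.Icc 1 s,
          ‖intervalSum q B A h‖ * ‖∑ n ∈ Finset.Ioc m (X / m), e q (h * m * n)‖ := by
          rw [← Finset.mul_sum]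
          ring
      _ ≤ q / (2 * h) * s + 2 * ∑ m ∈ Finset.Icc 1 s,
          (A * q / 2 * (1 / h * (1 / m)) + U (h * m)) := by
          gcongr with m hm
          · exact norm_intervalSum_le B A hh.1 hhq
          · rw [Finset.mem_Icc] at hm
            exact norm_intervalSum_mul_le B A hh.1 hhq hm.1 hm.2
      _ = _ := by
          congr 1
          field_simp
  have hsum1 : ∑ h ∈ Finset.Icc 1 (q / 2), ∑ m ∈ Finset.Icc 1 s, 1 / (h : ℝ) * (1 / (m : ℝ)) ≤
      L * L := by
    rw [← Finset.sum_mul_sum]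
    exact mul_le_mul (hsub _ (Nat.div_le_self _ _)) (hsub _ hsq)
      (Finset.sum_nonneg fun _ _ => by positivity) hL0
  have hsum2 : ∑ h ∈ Finset.Icc 1 (q / 2), ∑ m ∈ Finset.Icc 1 s, U (h * m) ≤
      D * (L * (X + 2 * s * q * L)) := by
    have hlt : q / 2 * s < q ^ 2 := by
      have : q / 2 < q := by omega
      nlinarith
    refine (sum_sum_mul_le U hU0 hlt hD).trans ?_
    gcongr
    rw [sq, sum_range_mul_eq]
    have h1 : ∀ i ∈ Finset.range q, ∑ r ∈ Finset.range q, U (q * i + r) =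
        (∑ r ∈ Finset.range q, majorant q X r) * (1 / ((i : ℝ) + 1)) := fun i _ => by
      rw [Finset.sum_mul]
      refine Finset.sum_congr rfl fun r hr => ?_
      have hrq := Finset.mem_range.1 hr
      simp only [hU]
      rw [Nat.mul_add_mod, Nat.mod_eq_of_lt hrq, Nat.mul_add_div hq, Nat.div_eq_of_lt hrq, add_zero]
    have h2 : ∑ i ∈ Finset.range q, 1 / ((i : ℝ) + 1) ≤ L := by
      have h3 := Finset.sum_Ico_add' (fun i : ℕ => 1 / (i : ℝ)) 0 q 1
      have h4 : Finset.Ico (0 + 1) (q + 1) = Finset.Icc 1 q := by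
        ext
        simp only [Finset.mem_Ico, Finset.mem_Icc]
        omega
      push_cast at h3
      rw [Finset.range_eq_Ico, h3, h4]
      exact hL
    rw [Finset.sum_congr rfl h1, ← Finset.mul_sum, mul_comm]
    have h3 := (sum_majorant_le hq X).trans
      (add_le_add_right (mul_le_mul_of_nonneg_left hL (by positivity)) _)
    exact mul_le_mul h2 h3 (Finset.sum_nonneg fun r hr =>
      majorant_nonneg X (Finset.mem_range.1 hr)) hL0
  calc _ ≤ _ := Finset.sum_le_sum hterm
    _ = s * q / 2 * ∑ h ∈ Finset.Icc 1 (q / 2), 1 / (h : ℝ) + 2 * (A * q / 2 *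
          ∑ h ∈ Finset.Icc 1 (q / 2), ∑ m ∈ Finset.Icc 1 s, 1 / (h : ℝ) * (1 / (m : ℝ)) +
          ∑ h ∈ Finset.Icc 1 (q / 2), ∑ m ∈ Finset.Icc 1 s, U (h * m)) := by
        simp only [Finset.sum_add_distrib, ← Finset.mul_sum]
    _ ≤ _ := by
        gcongr
        exact hsub _ (Nat.div_le_self _ _)

/-! ### Ramanujan sums and the averaged main term. -/

theorem ramanujanSum_eq_sum_ite {d : ℕ} (hd : d ≠ 0) (a : ℤ) :
    ramanujanSum d a =
      ∑ b ∈ d.divisors, if (b : ℤ) ∣ a then (b : ℤ) * ArithmeticFunction.moebius (d / b) else 0 := by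
  rw [ramanujanSum, ← Finset.sum_filter]
  refine Finset.sum_congr ?_ fun _ _ => rfl
  ext b
  simp only [Nat.mem_divisors, Finset.mem_filter, Int.gcd_eq_natAbs, Nat.dvd_gcd_iff,
    Int.natAbs_natCast, Int.natCast_dvd]
  refine ⟨fun h => ⟨⟨h.1.2, hd⟩, h.1.1⟩, fun h => ⟨⟨h.2, h.1.1⟩, ?_⟩⟩
  exact fun h0 => hd (Nat.eq_zero_of_gcd_eq_zero_right h0)

theorem abs_mul_card_filter_dvd_sub_le {b : ℕ} (hb : 1 ≤ b) (B : ℤ) (A : ℕ) :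
    |(b : ℤ) * ((Finset.Ioc B (B + (A : ℤ))).filter (fun a => (b : ℤ) ∣ a)).card - A| ≤ b := by
  have hb0 : (0 : ℤ) < b := by exact_mod_cast hb
  have hbQ : (0 : ℚ) < b := by exact_mod_cast hb
  rw [Int.Ioc_filter_dvd_card _ _ hb0]
  have h1 := Int.floor_le (((B + (A : ℤ) : ℤ) : ℚ) / ((b : ℤ) : ℚ))
  have h2 := Int.lt_floor_add_one (((B + (A : ℤ) : ℤ) : ℚ) / ((b : ℤ) : ℚ))
  have h3 := Int.floor_le ((B : ℚ) / ((b : ℤ) : ℚ))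
  have h4 := Int.lt_floor_add_one ((B : ℚ) / ((b : ℤ) : ℚ))
  have hle : ⌊(B : ℚ) / ((b : ℤ) : ℚ)⌋ ≤ ⌊((B + (A : ℤ) : ℤ) : ℚ) / ((b : ℤ) : ℚ)⌋ := by
    refine Int.floor_le_floor ?_
    push_cast
    gcongr
    simp
  rw [max_eq_left (sub_nonneg.2 hle)]
  set u := ⌊((B + (A : ℤ) : ℤ) : ℚ) / ((b : ℤ) : ℚ)⌋
  set v := ⌊(B : ℚ) / ((b : ℤ) : ℚ)⌋
  push_cast at h1 h2 h3 h4
  rw [le_div_iff₀ hbQ] at h1 h3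
  rw [div_lt_iff₀ hbQ] at h2 h4
  have h1' : u * b ≤ B + A := by exact_mod_cast h1
  have h2' : B + A < (u + 1) * b := by exact_mod_cast h2
  have h3' : v * b ≤ B := by exact_mod_cast h3
  have h4' : B < (v + 1) * b := by exact_mod_cast h4
  rw [abs_le]
  constructor <;> nlinarith

theorem sum_divisors_moebius_div {d : ℕ} (hd : 1 < d) :
    ∑ b ∈ d.divisors, ArithmeticFunction.moebius (d / b) = 0 := by
  rw [Nat.sum_div_divisors d (fun b => ArithmeticFunction.moebius b),
    ← ArithmeticFunction.coe_zeta_mul_apply, ArithmeticFunction.coe_zeta_mul_moebius,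
    ArithmeticFunction.one_apply_ne hd.ne']

/-- Each divisor `b` contributes `μ(d / b)` times `b` times the number of multiples of `b`, which is
`A` up to an error of at most `b ≤ d`. The terms `A` cancel since `∑ μ(d / b) = 0` for `d > 1`. -/
theorem abs_sum_ramanujanSum_le {d : ℕ} (hd : 1 < d) (B : ℤ) (A : ℕ) :
    |∑ a ∈ Finset.Ioc B (B + (A : ℤ)), ramanujanSum d a| ≤ d * d.divisors.card := by
  have h1 : ∑ a ∈ Finset.Ioc B (B + (A : ℤ)), ramanujanSum d a =
      ∑ b ∈ d.divisors, ArithmeticFunction.moebius (d / b) *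
        ((b : ℤ) * ((Finset.Ioc B (B + (A : ℤ))).filter (fun a => (b : ℤ) ∣ a)).card - A) := by
    rw [Finset.sum_congr rfl fun a _ => ramanujanSum_eq_sum_ite (by omega : d ≠ 0) a,
      Finset.sum_comm]
    simp only [mul_sub, Finset.sum_sub_distrib, ← Finset.sum_mul, sum_divisors_moebius_div hd,
      zero_mul, sub_zero]
    refine Finset.sum_congr rfl fun b _ => ?_
    rw [← Finset.sum_filter, Finset.sum_const, nsmul_eq_mul]
    ring
  rw [h1]
  refine (Finset.abs_sum_le_sum_abs _ _).trans ?_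
  calc _ ≤ ∑ _b ∈ d.divisors, (d : ℤ) := by
        refine Finset.sum_le_sum fun b hb => ?_
        have hb1 : 1 ≤ b := Nat.pos_of_mem_divisors hb
        rw [abs_mul]
        calc _ ≤ 1 * (b : ℤ) := mul_le_mul ArithmeticFunction.abs_moebius_le_one
              (abs_mul_card_filter_dvd_sub_le hb1 B A) (abs_nonneg _) zero_le_one
          _ ≤ d := by
            rw [one_mul]
            exact_mod_cast Nat.divisor_le hb
    _ = _ := by
        rw [Finset.sum_const, nsmul_eq_mul, mul_comm]

/-- The subtracted quantity is exactly the `d = 1` term. Each other `d` contributes at most `τ(d)`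
times a logarithmic factor, which `X ≤ q ^ 2` bounds by `4 (1 + log q)`. -/
theorem abs_sum_M_sub_le {q X : ℕ} (hq : 1 ≤ q) (hX1 : 1 ≤ X) (hX : X ≤ q ^ 2) (B : ℤ) (A : ℕ)
    {D : ℝ} (hD : ∀ l : ℕ, 1 ≤ l → l ≤ q ^ 2 → (l.divisors.card : ℝ) ≤ D) :
    |∑ a ∈ Finset.Ioc B (B + (A : ℤ)), M X a q -
        A / q * (X * (Real.log X + 2 * Real.eulerMascheroniConstant - 1))| ≤
      X / q * (D * (D * (4 * (1 + Real.log q)))) := by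
  set Q : ℕ → ℝ := fun d => Real.log X - 2 * Real.log d + 2 * Real.eulerMascheroniConstant - 1
    with hQ
  have hqq : q ≤ q ^ 2 := by nlinarith
  have hD0 : 0 ≤ D := (Nat.cast_nonneg _).trans (hD 1 le_rfl (Nat.one_le_pow _ _ hq))
  have hlogq : 0 ≤ Real.log q := Real.log_nonneg (by exact_mod_cast hq)
  have hlogX : 0 ≤ Real.log X := Real.log_nonneg (by exact_mod_cast hX1)
  have hlogXq : Real.log X ≤ 2 * Real.log q := by
    calc Real.log X ≤ Real.log ((q : ℝ) ^ 2) :=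
          Real.log_le_log (by exact_mod_cast hX1) (by exact_mod_cast hX)
      _ = _ := by rw [Real.log_pow]; norm_num
  have h1 : ∑ a ∈ Finset.Ioc B (B + (A : ℤ)), M X a q =
      X / q * ∑ d ∈ q.divisors,
        ((∑ a ∈ Finset.Ioc B (B + (A : ℤ)), ramanujanSum d a : ℤ) : ℝ) / d * Q d := by
    simp only [M, P, ← Finset.mul_sum]
    rw [Finset.sum_comm]
    congr 1
    refine Finset.sum_congr rfl fun d _ => ?_
    rw [← Finset.sum_mul, ← Finset.sum_div, Int.cast_sum]
  have hone : ∑ a ∈ Finset.Ioc B (B + (A : ℤ)), ramanujanSum 1 a = A := by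
    simp [ramanujanSum]
  have hmem : 1 ∈ q.divisors := Nat.one_mem_divisors.2 (by omega)
  have h2 : ∑ a ∈ Finset.Ioc B (B + (A : ℤ)), M X a q -
        A / q * (X * (Real.log X + 2 * Real.eulerMascheroniConstant - 1)) =
      X / q * ∑ d ∈ q.divisors.erase 1,
        ((∑ a ∈ Finset.Ioc B (B + (A : ℤ)), ramanujanSum d a : ℤ) : ℝ) / d * Q d := by
    rw [h1, ← Finset.add_sum_erase _ _ hmem, hone]
    simp only [hQ, Nat.cast_one, Real.log_one, Int.cast_natCast]
    ring
  rw [h2, abs_mul, abs_of_nonneg (by positivity : (0 : ℝ) ≤ X / q)]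
  refine mul_le_mul_of_nonneg_left ?_ (by positivity)
  refine (Finset.abs_sum_le_sum_abs _ _).trans ?_
  calc _ ≤ ∑ _d ∈ q.divisors.erase 1, D * (4 * (1 + Real.log q)) := by
        refine Finset.sum_le_sum fun d hd => ?_
        have hdq := Nat.mem_divisors.1 (Finset.mem_of_mem_erase hd)
        have hd0 : 0 < d := Nat.pos_of_mem_divisors (Finset.mem_of_mem_erase hd)
        have hd1 : 1 < d := by
          have := Finset.ne_of_mem_erase hd
          omega
        have hdR : (0 : ℝ) < d := by exact_mod_cast hd0
        have hdle : d ≤ q := Nat.le_of_dvd (by omega) hdq.1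
        rw [abs_mul, abs_div, Nat.abs_cast]
        refine mul_le_mul ?_ ?_ (abs_nonneg _) hD0
        · rw [div_le_iff₀ hdR, mul_comm]
          have h3 : |((∑ a ∈ Finset.Ioc B (B + (A : ℤ)), ramanujanSum d a : ℤ) : ℝ)| ≤
              d * d.divisors.card := by
            exact_mod_cast abs_sum_ramanujanSum_le hd1 B A
          refine h3.trans ?_
          gcongr
          exact hD d hd0 (hdle.trans hqq)
        · have hlogd0 : 0 ≤ Real.log d := Real.log_nonneg (by exact_mod_cast hd0)
          have hlogd : Real.log d ≤ Real.log q := Real.log_le_log hdR (by exact_mod_cast hdle)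
          have hg1 := Real.one_half_lt_eulerMascheroniConstant
          have hg2 := Real.eulerMascheroniConstant_lt_two_thirds
          rw [abs_le]
          constructor <;> simp only [hQ] <;> linarith
    _ ≤ _ := by
        rw [Finset.sum_const, nsmul_eq_mul]
        refine mul_le_mul_of_nonneg_right ?_ (by positivity)
        refine le_trans ?_ (hD q hq hqq)
        exact_mod_cast Finset.card_le_card (Finset.erase_subset _ _)

/-! ### The elementary bound for the error term. -/

/-- The elementary bound for the average of the error term over an interval of residues. -/
theorem abs_E_le {q X : ℕ} (hq : 1 ≤ q) (hX1 : 1 ≤ X) (hX : X ≤ q ^ 2) (B : ℤ) {A : ℕ}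
    (hA : A ≤ q) {D : ℝ}
    (hD : ∀ l : ℕ, 1 ≤ l → l ≤ q ^ 2 → (l.divisors.card : ℝ) ≤ D) :
    |E X B A q| ≤ 35 * D ^ 2 * (1 + Real.log q) ^ 2 * (A + √(X : ℝ)) := by
  set L := 1 + Real.log q with hLdef
  have hq0 : (0 : ℝ) < q := by exact_mod_cast hq
  have hL : ∑ m ∈ Finset.Icc 1 q, 1 / (m : ℝ) ≤ L := sum_one_div_le q
  have hL1 : 1 ≤ L := by
    have : 0 ≤ Real.log q := Real.log_nonneg (by exact_mod_cast hq)
    linarith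
  have hD1 : 1 ≤ D := by simpa using hD 1 le_rfl (Nat.one_le_pow _ _ hq)
  have h1 := (abs_sum_S_sub_le hq X B A).trans
    (mul_le_mul_of_nonneg_left (sum_norm_intervalSum_mul_le hq hX B A hD hL) (by positivity))
  have h2 := abs_sum_M_sub_le hq hX1 hX B A hD
  have h3 := abs_sum_card_divisors_sub_le hX1
  rw [← hLdef] at h2
  set t := √(X : ℝ) with ht
  have ht0 : 0 ≤ t := Real.sqrt_nonneg _
  have htt : t * t = X := Real.mul_self_sqrt (by positivity)
  have hst : (Nat.sqrt X : ℝ) ≤ t := Real.nat_sqrt_le_real_sqrt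
  have htq : t ≤ q := by
    rw [ht, Real.sqrt_le_left hq0.le]
    exact_mod_cast hX
  have hXq : (X : ℝ) / q ≤ t := by
    rw [div_le_iff₀ hq0, ← htt]
    gcongr
  have h3' : |A / q * ∑ n ∈ Finset.Icc 1 X, (n.divisors.card : ℝ) -
      A / q * (X * (Real.log X + 2 * Real.eulerMascheroniConstant - 1))| ≤ 16 * t := by
    rw [← mul_sub, abs_mul, abs_of_nonneg (by positivity)]
    calc _ ≤ 1 * (16 * t) := by
          refine mul_le_mul ?_ h3 (abs_nonneg _) zero_le_one
          rw [div_le_one hq0]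
          exact_mod_cast hA
      _ = _ := one_mul _
  have h1' : |∑ a ∈ Finset.Ioc B (B + (A : ℤ)), S X a q -
        A / q * ∑ n ∈ Finset.Icc 1 X, (n.divisors.card : ℝ)| ≤
      t * L + 2 * A * (L * L) + 4 * D * (L * (t + 2 * t * L)) := by
    refine h1.trans ?_
    have : 2 / (q : ℝ) * (Nat.sqrt X * q / 2 * L +
        2 * (A * q / 2 * (L * L) + D * (L * (X + 2 * Nat.sqrt X * q * L)))) =
        Nat.sqrt X * L + 2 * A * (L * L) + 4 * D * (L * (X / q + 2 * Nat.sqrt X * L)) := by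
      field_simp
      ring
    rw [this]
    gcongr
  have h2' : X / q * (D * (D * (4 * L))) ≤ t * (D * (D * (4 * L))) := by gcongr
  have hE : E X B A q = (∑ a ∈ Finset.Ioc B (B + (A : ℤ)), S X a q -
        A / q * ∑ n ∈ Finset.Icc 1 X, (n.divisors.card : ℝ)) +
      (A / q * ∑ n ∈ Finset.Icc 1 X, (n.divisors.card : ℝ) -
        A / q * (X * (Real.log X + 2 * Real.eulerMascheroniConstant - 1))) -
      (∑ a ∈ Finset.Ioc B (B + (A : ℤ)), M X a q -
        A / q * (X * (Real.log X + 2 * Real.eulerMascheroniConstant - 1))) := by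
    simp only [E, R, Finset.sum_sub_distrib]
    ring
  have hLL : L ≤ D ^ 2 * L ^ 2 := by
    calc L = 1 * (1 * L) := by ring
      _ ≤ D ^ 2 * (L * L) := by gcongr; exact one_le_pow₀ hD1
      _ = _ := by ring
  have h1DL : 1 ≤ D ^ 2 * L ^ 2 := hL1.trans hLL
  have hLL2 : L * L ≤ D ^ 2 * L ^ 2 := by
    rw [← sq]
    exact le_mul_of_one_le_left (by positivity) (one_le_pow₀ hD1)
  have hDLL : D * (L * L) ≤ D ^ 2 * L ^ 2 := by
    rw [← sq, sq D]
    gcongr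
    nlinarith
  have hDL : D * L ≤ D ^ 2 * L ^ 2 := by
    refine le_trans ?_ hDLL
    gcongr
    nlinarith
  have hDDL : D * (D * L) ≤ D ^ 2 * L ^ 2 := by
    rw [← mul_assoc, ← sq]
    gcongr
    nlinarith
  have htot : |E X B A q| ≤ t * L + 2 * A * (L * L) + 4 * D * (L * (t + 2 * t * L)) + 16 * t +
      t * (D * (D * (4 * L))) := by
    rw [hE]
    exact (abs_sub _ _).trans
      (add_le_add ((abs_add_le _ _).trans (add_le_add h1' h3')) (h2.trans h2'))
  -- Every product of `D` and `L` that occurs is at most `W`, as `D, L ≥ 1`. The coefficients then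
  -- total `33` for `t W` and `2` for `A W`, within the stated `35`.
  set W := D ^ 2 * L ^ 2 with hW
  have a1 : t * L ≤ t * W := by gcongr
  have a2 : (A : ℝ) * (L * L) ≤ A * W := by gcongr
  have a3 : t * (D * L) ≤ t * W := by gcongr
  have a4 : t * (D * (L * L)) ≤ t * W := by gcongr
  have a5 : t * 1 ≤ t * W := by gcongr
  have a6 : t * (D * (D * L)) ≤ t * W := by gcongr
  have a7 : (0 : ℝ) ≤ A * W := by positivity
  have e1 : 35 * D ^ 2 * L ^ 2 * (A + t) = 35 * (A * W + t * W) := by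
    rw [hW]
    ring
  rw [e1]
  refine htot.trans ?_
  have e2 : t * L + 2 * A * (L * L) + 4 * D * (L * (t + 2 * t * L)) + 16 * t +
      t * (D * (D * (4 * L))) = t * L + 2 * (A * (L * L)) + 4 * (t * (D * L)) +
        8 * (t * (D * (L * L))) + 16 * (t * 1) + 4 * (t * (D * (D * L))) := by ring
  rw [e2]
  linarith

/-- Power form of the elementary bound, with a loss of `q ^ ε`. -/
theorem exists_abs_E_le {ε : ℝ} (hε : 0 < ε) :
    ∃ C : ℝ, 1 ≤ C ∧ ∀ (A X q : ℕ) (B : ℤ), 1 ≤ q → 1 ≤ X → X ≤ q ^ 2 → A ≤ q →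
      |E X B A q| ≤ C * (q : ℝ) ^ ε * (A + √(X : ℝ)) := by
  -- The divisor bound is used for integers up to `q ^ 2` and squared, costing `q ^ (4 ν)`; the
  -- squared logarithm costs `q ^ (2 ν)`.
  set ν := ε / 6 with hν
  have hν0 : 0 < ν := by positivity
  obtain ⟨C, hC1, hC⟩ := exists_card_divisors_le hν0
  refine ⟨35 * C ^ 2 * (1 + 1 / ν) ^ 2, ?_, fun A X q B hq hX1 hX hA => ?_⟩
  · have h1 : 1 ≤ C ^ 2 := one_le_pow₀ hC1
    have h2 : 1 ≤ (1 + 1 / ν) ^ 2 := one_le_pow₀ (by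
      have : 0 ≤ 1 / ν := by positivity
      linarith)
    nlinarith
  have hqR : (1 : ℝ) ≤ q := by exact_mod_cast hq
  have hq0 : (0 : ℝ) < q := by linarith
  have hD : ∀ l : ℕ, 1 ≤ l → l ≤ q ^ 2 → (l.divisors.card : ℝ) ≤ C * ((q : ℝ) ^ 2) ^ ν := by
    intro l hl hlq
    refine (hC l hl).trans ?_
    gcongr
    exact_mod_cast hlq
  refine (abs_E_le hq hX1 hX B hA hD).trans ?_
  have hL : 1 + Real.log q ≤ (1 + 1 / ν) * (q : ℝ) ^ ν := by
    have h1 := Real.log_le_rpow_div hq0.le hν0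
    have h2 : 1 ≤ (q : ℝ) ^ ν := Real.one_le_rpow hqR hν0.le
    calc 1 + Real.log q ≤ (q : ℝ) ^ ν + (q : ℝ) ^ ν / ν := add_le_add h2 h1
      _ = _ := by ring
  have hlog : 0 ≤ Real.log q := Real.log_nonneg hqR
  calc _ ≤ 35 * (C * ((q : ℝ) ^ 2) ^ ν) ^ 2 * ((1 + 1 / ν) * (q : ℝ) ^ ν) ^ 2 * (A + √(X : ℝ)) := by
        gcongr
    _ = _ := by
        have h1 : (q : ℝ) ^ ε = ((q : ℝ) ^ ν) ^ 6 := by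
          rw [← Real.rpow_mul_natCast hq0.le]
          congr 1
          rw [hν]
          push_cast
          ring
        have h2 : ((q : ℝ) ^ 2) ^ ν = ((q : ℝ) ^ ν) ^ 2 := (Real.rpow_pow_comm hq0.le ν 2).symm
        rw [h1, h2]
        ring

/-! ### From `ε`-losses to a vanishing exponent. -/

/-- If a monotone family of bounds holds for each `q ≥ 1` with some exponent, and with every
positive exponent for large `q`, then it holds with an exponent tending to zero. -/
theorem exists_exponent_tendsto_zero (Φ : ℕ → ℝ → Prop)
    (hmono : ∀ q d d', 1 ≤ q → d ≤ d' → Φ q d → Φ q d') (hex : ∀ q, 1 ≤ q → ∃ d, Φ q d)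
    (hev : ∀ ε : ℝ, 0 < ε → ∀ᶠ q in atTop, Φ q ε) :
    ∃ δ : ℕ → ℝ, Tendsto δ atTop (𝓝 0) ∧ ∀ q, 1 ≤ q → Φ q (δ q) := by
  set T : ℕ → Set ℝ := fun q => {d | 0 ≤ d ∧ Φ q d} with hT
  have hbdd : ∀ q, BddBelow (T q) := fun q => ⟨0, fun d hd => hd.1⟩
  -- The infimum need not be attained, so a positive null sequence is added to pass above an
  -- admissible exponent.
  refine ⟨fun q => sInf (T q) + 1 / ((q : ℝ) + 1), ?_, fun q hq => ?_⟩
  · have h1 : Tendsto (fun q => sInf (T q)) atTop (𝓝 0) := by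
      rw [Metric.tendsto_nhds]
      intro ε hε
      filter_upwards [hev (ε / 2) (half_pos hε)] with q hq
      rw [Real.dist_0_eq_abs, abs_of_nonneg (Real.sInf_nonneg fun d hd => hd.1)]
      exact (csInf_le (hbdd q) ⟨(half_pos hε).le, hq⟩).trans_lt (half_lt_self hε)
    simpa using h1.add (tendsto_one_div_add_atTop_nhds_zero_nat (𝕜 := ℝ))
  · obtain ⟨d, hd⟩ := hex q hq
    have hne : (T q).Nonempty :=
      ⟨max d 0, le_max_right _ _, hmono q d _ hq (le_max_left _ _) hd⟩
    obtain ⟨d', hd', hlt⟩ := exists_lt_of_csInf_lt hne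
      (lt_add_of_pos_right (sInf (T q)) (by positivity : (0 : ℝ) < 1 / ((q : ℝ) + 1)))
    exact hmono q d' _ hq hlt.le hd'.2

/-! ### Comparison with the three-term bound. -/

/-- The three-term bound for `E X B A q`, up to a factor `q ^ o(1)`. -/
noncomputable def bound (A X q : ℕ) : ℝ :=
  (A : ℝ) * (X : ℝ) ^ (1 / 2 : ℝ) * (q : ℝ) ^ (-1 / 2 : ℝ)
    + (A : ℝ) ^ (1 / 8 : ℝ) * (X : ℝ) ^ (1 / 4 : ℝ) * (q : ℝ) ^ (1 / 2 : ℝ)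
    + (A : ℝ) ^ (1 / 2 : ℝ) * (X : ℝ) ^ (1 / 4 : ℝ) * (q : ℝ) ^ (1 / 4 : ℝ)

theorem bound_nonneg (A X q : ℕ) : 0 ≤ bound A X q := by
  rw [bound]
  positivity

theorem E_zero_length (X : ℕ) (B : ℤ) (q : ℕ) : E X B 0 q = 0 := by
  simp [E]

theorem le_sq_of_rpow_le {X q : ℕ} (hq : 1 ≤ q) {c : ℝ} (hc : 1 / 2 ≤ c)
    (h : (X : ℝ) ^ c ≤ q) : X ≤ q ^ 2 := by
  have hc0 : 0 < c := by linarith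
  have hqR : (1 : ℝ) ≤ q := by exact_mod_cast hq
  have h1 : (X : ℝ) ≤ (q : ℝ) ^ (1 / c) := by
    calc (X : ℝ) = ((X : ℝ) ^ c) ^ (1 / c) := by
          rw [← Real.rpow_mul (by positivity), mul_one_div_cancel hc0.ne', Real.rpow_one]
      _ ≤ _ := by gcongr
  have h2 : (q : ℝ) ^ (1 / c) ≤ (q : ℝ) ^ (2 : ℝ) := by
    refine Real.rpow_le_rpow_of_exponent_le hqR ?_
    rw [div_le_iff₀ hc0]
    linarith
  rw [Real.rpow_two] at h2
  exact_mod_cast h1.trans h2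

/-- From `q ≤ X`, the first term is at least `A`; from `X ^ (1/4) ≤ q ^ (1/2)` and `A ≥ 1`, the
second is at least `√X`. -/
theorem add_sqrt_le_bound {A X q : ℕ} (hA : 1 ≤ A) (hq : 1 ≤ q) (hqX : q ≤ X)
    (hXq : X ≤ q ^ 2) : A + √(X : ℝ) ≤ bound A X q := by
  have hAR : (1 : ℝ) ≤ A := by exact_mod_cast hA
  have hq0 : (0 : ℝ) < q := by exact_mod_cast hq
  have h1 : (A : ℝ) ≤ A * (X : ℝ) ^ (1 / 2 : ℝ) * (q : ℝ) ^ (-1 / 2 : ℝ) := by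
    have : 1 ≤ (X : ℝ) ^ (1 / 2 : ℝ) * (q : ℝ) ^ (-1 / 2 : ℝ) := by
      calc (1 : ℝ) = (q : ℝ) ^ (1 / 2 : ℝ) * (q : ℝ) ^ (-1 / 2 : ℝ) := by
            rw [← Real.rpow_add hq0]
            norm_num
        _ ≤ _ := by gcongr
    rw [mul_assoc]
    exact le_mul_of_one_le_right (by positivity) this
  have h2 : √(X : ℝ) ≤ (A : ℝ) ^ (1 / 8 : ℝ) * (X : ℝ) ^ (1 / 4 : ℝ) * (q : ℝ) ^ (1 / 2 : ℝ) := by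
    have h3 : (X : ℝ) ^ (1 / 4 : ℝ) ≤ (q : ℝ) ^ (1 / 2 : ℝ) := by
      calc (X : ℝ) ^ (1 / 4 : ℝ) ≤ ((q : ℝ) ^ (2 : ℝ)) ^ (1 / 4 : ℝ) := by
            gcongr
            rw [Real.rpow_two]
            exact_mod_cast hXq
        _ = _ := by
            rw [← Real.rpow_mul hq0.le]
            norm_num
    have h4 : (1 : ℝ) ≤ (A : ℝ) ^ (1 / 8 : ℝ) := Real.one_le_rpow hAR (by norm_num)
    have hX0 : (0 : ℝ) < X := by exact_mod_cast hq.trans hqX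
    calc √(X : ℝ) = 1 * (X : ℝ) ^ (1 / 4 : ℝ) * (X : ℝ) ^ (1 / 4 : ℝ) := by
          rw [one_mul, ← Real.rpow_add hX0, Real.sqrt_eq_rpow]
          norm_num
      _ ≤ _ := by gcongr
  have h3 : 0 ≤ (A : ℝ) ^ (1 / 2 : ℝ) * (X : ℝ) ^ (1 / 4 : ℝ) * (q : ℝ) ^ (1 / 4 : ℝ) := by
    positivity
  rw [bound]
  linarith

theorem exists_abs_E_le_bound {ε : ℝ} (hε : 0 < ε) :
    ∃ C : ℝ, 1 ≤ C ∧ ∀ (A X q : ℕ) (B : ℤ), 1 ≤ q → A ≤ q → q ≤ X →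
      (X : ℝ) ^ (19 / 31 : ℝ) ≤ (q : ℝ) → |E X B A q| ≤ bound A X q * (C * (q : ℝ) ^ ε) := by
  obtain ⟨C, hC1, hC⟩ := exists_abs_E_le hε
  refine ⟨C, hC1, fun A X q B hq hAq hqX hX => ?_⟩
  have hXq : X ≤ q ^ 2 := le_sq_of_rpow_le hq (by norm_num) hX
  rcases Nat.eq_zero_or_pos A with rfl | hA
  · rw [E_zero_length, abs_zero]
    exact mul_nonneg (bound_nonneg _ _ _) (by positivity)
  · rw [mul_comm]
    refine (hC A X q B hq (hq.trans hqX) hXq hAq).trans ?_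
    exact mul_le_mul_of_nonneg_left (add_sqrt_le_bound hA hq hqX hXq) (by positivity)

/-- At `q = 1` no power of `q` can absorb a constant, so this case is computed: the error is `2 -
2γ`, with `1/2 < γ < 2/3`. -/
theorem abs_E_one_le (B : ℤ) : |E 1 B 1 1| ≤ 1 := by
  have hIoc : Finset.Ioc B (B + ((1 : ℕ) : ℤ)) = {B + 1} := by
    ext
    simp only [Finset.mem_Ioc, Finset.mem_singleton]
    omega
  have hS : S 1 (B + 1) 1 = 1 := by
    simp [S, Int.modEq_one]
  have hM : M 1 (B + 1) 1 = 2 * Real.eulerMascheroniConstant - 1 := by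
    simp [M, P, ramanujanSum]
  have hg1 := Real.one_half_lt_eulerMascheroniConstant
  have hg2 := Real.eulerMascheroniConstant_lt_two_thirds
  rw [E, hIoc, Finset.sum_singleton, R, hS, hM, abs_le]
  constructor <;> linarith

theorem abs_E_le_bound_of_modulus_one {A X : ℕ} (B : ℤ) (hA : A ≤ 1) (hX1 : 1 ≤ X)
    (hX : X ≤ 1) : |E X B A 1| ≤ bound A X 1 := by
  obtain rfl : X = 1 := le_antisymm hX hX1
  rcases Nat.eq_zero_or_pos A with rfl | hA0
  · rw [E_zero_length, abs_zero]
    exact bound_nonneg _ _ _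
  · obtain rfl : A = 1 := le_antisymm hA hA0
    refine (abs_E_one_le B).trans ?_
    simp only [bound, Nat.cast_one, Real.one_rpow]
    norm_num

theorem exists_abs_E_le_bound_mul_rpow :
    ∃ δ : ℕ → ℝ, Tendsto δ atTop (𝓝 0) ∧
      ∀ (A X q : ℕ) (B : ℤ), 1 ≤ q → A ≤ q → q ≤ X → (X : ℝ) ^ (19 / 31 : ℝ) ≤ (q : ℝ) →
        |E X B A q| ≤ bound A X q * (q : ℝ) ^ (δ q) := by
  suffices h : ∃ δ : ℕ → ℝ, Tendsto δ atTop (𝓝 0) ∧ ∀ q : ℕ, 1 ≤ q →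
      ∀ (A X : ℕ) (B : ℤ), A ≤ q → q ≤ X → (X : ℝ) ^ (19 / 31 : ℝ) ≤ (q : ℝ) →
        |E X B A q| ≤ bound A X q * (q : ℝ) ^ (δ q) by
    obtain ⟨δ, hδ, h⟩ := h
    exact ⟨δ, hδ, fun A X q B hq => h q hq A X B⟩
  refine exists_exponent_tendsto_zero
    (fun q d => ∀ (A X : ℕ) (B : ℤ), A ≤ q → q ≤ X → (X : ℝ) ^ (19 / 31 : ℝ) ≤ (q : ℝ) →
      |E X B A q| ≤ bound A X q * (q : ℝ) ^ d) ?_ ?_ ?_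
  · intro q d d' hq hd h A X B hA hqX hX
    refine (h A X B hA hqX hX).trans (mul_le_mul_of_nonneg_left ?_ (bound_nonneg _ _ _))
    exact Real.rpow_le_rpow_of_exponent_le (by exact_mod_cast hq) hd
  · intro q hq
    rcases hq.eq_or_lt with rfl | hq1
    · refine ⟨0, fun A X B hA hqX hX => ?_⟩
      rw [Real.rpow_zero, mul_one]
      exact abs_E_le_bound_of_modulus_one B hA hqX
        (by simpa using le_sq_of_rpow_le le_rfl (by norm_num) hX)
    · obtain ⟨C, -, hC⟩ := exists_abs_E_le_bound one_pos
      have hqR : (1 : ℝ) < q := by exact_mod_cast hq1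
      obtain ⟨k, hk⟩ := pow_unbounded_of_one_lt C hqR
      refine ⟨k + 1, fun A X B hA hqX hX => (hC A X q B hq hA hqX hX).trans
        (mul_le_mul_of_nonneg_left ?_ (bound_nonneg _ _ _))⟩
      rw [Real.rpow_add (by linarith), Real.rpow_natCast]
      gcongr
  · intro ε hε
    obtain ⟨C, -, hC⟩ := exists_abs_E_le_bound (half_pos hε)
    have hlarge : ∀ᶠ q : ℕ in atTop, C ≤ (q : ℝ) ^ (ε / 2) :=
      ((tendsto_rpow_atTop (half_pos hε)).comp tendsto_natCast_atTop_atTop).eventually_ge_atTop C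
    filter_upwards [hlarge, eventually_ge_atTop 1] with q hqC hq A X B hA hqX hX
    refine (hC A X q B hq hA hqX hX).trans
      (mul_le_mul_of_nonneg_left ?_ (bound_nonneg _ _ _))
    calc C * (q : ℝ) ^ (ε / 2) ≤ (q : ℝ) ^ (ε / 2) * (q : ℝ) ^ (ε / 2) := by gcongr
      _ = (q : ℝ) ^ ε := by
        rw [← Real.rpow_add (by exact_mod_cast hq), add_halves]

/-! ### The power saving near `q = X ^ (2/3)`. -/

theorem exists_abs_E_le_power_saving :
    ∃ K : ℝ, 0 < K ∧ ∀ (A X q : ℕ) (B : ℤ), 1 ≤ q → A ≤ q →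
        (X : ℝ) ^ (2 / 3 - 1 / 100 : ℝ) ≤ (q : ℝ) → (q : ℝ) ≤ (X : ℝ) ^ (2 / 3 + 1 / 100 : ℝ) →
        (q : ℝ) ^ (3 / 7 : ℝ) ≤ (A : ℝ) →
        |E X B A q| ≤ K * ((A : ℝ) * (X : ℝ) / (q : ℝ)) * (q : ℝ) ^ (-(1 / 100) : ℝ) := by
  obtain ⟨C, hC1, hC⟩ := exists_abs_E_le (ε := 1 / 100) (by norm_num)
  refine ⟨2 * C, by linarith, fun A X q B hq hAq hX hqX hA => ?_⟩
  have hqR : (1 : ℝ) ≤ q := by exact_mod_cast hq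
  have hq0 : (0 : ℝ) < q := by linarith
  have hX1 : 1 ≤ X := by
    rw [Nat.one_le_iff_ne_zero]
    rintro rfl
    rw [Nat.cast_zero, Real.zero_rpow (by norm_num)] at hqX
    linarith
  have hXR : (1 : ℝ) ≤ X := by exact_mod_cast hX1
  have hX0 : (0 : ℝ) < X := by linarith
  have hXq : X ≤ q ^ 2 := le_sq_of_rpow_le hq (by norm_num) hX
  -- `300 / 203` is the reciprocal of `2 / 3 + 1 / 100`.
  have hpow : (q : ℝ) ^ (300 / 203 : ℝ) ≤ X := by
    calc (q : ℝ) ^ (300 / 203 : ℝ) ≤ ((X : ℝ) ^ (2 / 3 + 1 / 100 : ℝ)) ^ (300 / 203 : ℝ) := by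
          gcongr
      _ = X := by
          rw [← Real.rpow_mul hX0.le]
          norm_num
  -- `51 / 50 = 1 + 1 / 100 + 1 / 100` pays for the division by `q`, the loss in the elementary
  -- bound and the saving claimed. Both `X` and `A √X` must exceed this power of `q`.
  have hkey : (q : ℝ) ^ (1 / 100 : ℝ) = (q : ℝ) ^ (51 / 50 : ℝ) / q * (q : ℝ) ^ (-(1 / 100) : ℝ) := by
    rw [← Real.rpow_sub_one hq0.ne', ← Real.rpow_add hq0]
    norm_num
  have h1 : (q : ℝ) ^ (51 / 50 : ℝ) ≤ X :=
    (Real.rpow_le_rpow_of_exponent_le hqR (by norm_num)).trans hpow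
  have h2 : (q : ℝ) ^ (51 / 50 : ℝ) ≤ A * √(X : ℝ) := by
    calc (q : ℝ) ^ (51 / 50 : ℝ) ≤ (q : ℝ) ^ (3 / 7 + 150 / 203 : ℝ) :=
          Real.rpow_le_rpow_of_exponent_le hqR (by norm_num)
      _ = (q : ℝ) ^ (3 / 7 : ℝ) * ((q : ℝ) ^ (300 / 203 : ℝ)) ^ (1 / 2 : ℝ) := by
          rw [← Real.rpow_mul hq0.le, ← Real.rpow_add hq0]
          norm_num
      _ ≤ A * √(X : ℝ) := by
          rw [Real.sqrt_eq_rpow]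
          gcongr
  have h3 : (q : ℝ) ^ (51 / 50 : ℝ) * (A + √(X : ℝ)) ≤ 2 * (A * X) := by
    have h4 : (q : ℝ) ^ (51 / 50 : ℝ) * A ≤ X * A := by gcongr
    have h5 : (q : ℝ) ^ (51 / 50 : ℝ) * √(X : ℝ) ≤ A * √(X : ℝ) * √(X : ℝ) := by gcongr
    rw [mul_assoc, Real.mul_self_sqrt hX0.le] at h5
    linarith
  refine (hC A X q B hq hX1 hXq hAq).trans ?_
  rw [hkey]
  calc _ = C / q * (q : ℝ) ^ (-(1 / 100) : ℝ) * ((q : ℝ) ^ (51 / 50 : ℝ) * (A + √(X : ℝ))) := by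
        ring
    _ ≤ C / q * (q : ℝ) ^ (-(1 / 100) : ℝ) * (2 * (A * X)) := by gcongr
    _ = _ := by ring

end DivisorAP

theorem theorem1p2 :
    (∃ δ : ℕ → ℝ, Tendsto δ atTop (𝓝 0) ∧
      ∀ (A X q : ℕ) (B : ℤ), 1 ≤ q → A ≤ q → q ≤ X → (X : ℝ) ^ (19 / 31 : ℝ) ≤ (q : ℝ) →
        |DivisorAP.E X B A q| ≤
          ((A : ℝ) * (X : ℝ) ^ (1 / 2 : ℝ) * (q : ℝ) ^ (-1 / 2 : ℝ)
            + (A : ℝ) ^ (1 / 8 : ℝ) * (X : ℝ) ^ (1 / 4 : ℝ) * (q : ℝ) ^ (1 / 2 : ℝ)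
            + (A : ℝ) ^ (1 / 2 : ℝ) * (X : ℝ) ^ (1 / 4 : ℝ) * (q : ℝ) ^ (1 / 4 : ℝ))
          * (q : ℝ) ^ (δ q)) ∧
    (∀ ε : ℝ, 0 < ε → ∃ η : ℝ, 0 < η ∧ ∃ K : ℝ, 0 < K ∧
      ∀ (A X q : ℕ) (B : ℤ), 1 ≤ q → A ≤ q →
        (X : ℝ) ^ (2 / 3 - η) ≤ (q : ℝ) → (q : ℝ) ≤ (X : ℝ) ^ (2 / 3 + η) →
        (q : ℝ) ^ (3 / 7 + ε) ≤ (A : ℝ) →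
        |DivisorAP.E X B A q| ≤ K * ((A : ℝ) * (X : ℝ) / (q : ℝ)) * (q : ℝ) ^ (-η)) := by
  refine ⟨DivisorAP.exists_abs_E_le_bound_mul_rpow, fun ε hε => ?_⟩
  obtain ⟨K, hK, h⟩ := DivisorAP.exists_abs_E_le_power_saving
  -- The saving already holds for `A ≥ q ^ (3/7)`, so `η` and `K` do not depend on `ε`.
  refine ⟨1 / 100, by norm_num, K, hK, fun A X q B hq hAq hX hqX hA => ?_⟩
  refine h A X q B hq hAq hX hqX (le_trans ?_ hA)
  exact Real.rpow_le_rpow_of_exponent_le (by exact_mod_cast hq) (by linarith)
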